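/- Let $E$ be a locally compact separable metric space with a $\sigma$-finite Borel measure $\mu$, and let $L_2(E,\mu)$ be the complex Hilbert space of square-integrable functions. Let $\mathscr I_1(E,\mu)$ be the ideal of trace class operators on $L_2(E,\mu)$ with norm $\|A\|_1=\operatorname{tr}|A|$, and let $\mathscr I_{1,\mathrm{loc}}(E,\mu)$ be the space of bounded operators $K$ on $L_2(E,\mu)$ such that $\chi_BK\chi_B\in\mathscr I_1(E,\mu)$ for every bounded Borel set $B\subset E$; $K_n\to K$ in $\mathscr I_{1,\mathrm{loc}}(E,\mu)$ means $\|\chi_B(K_n-K)\chi_B\|_1\to0$ for every such $B$. Let $\mathrm{Conf}(E)$ be the space of configurations on $E$ (collections of points, possibly with multiplicities, with finitely many points in each bounded set), with the $\sigma$-algebra generated by the numbers $\#_B$ of points in bounded Borel sets $B$. An operator $K\in\mathscr I_{1,\mathrm{loc}}(E,\mu)$ induces the determinantal probability measure $\mathbb P_K$ on $\mathrm{Conf}(E)$ if $$\int_{\mathrm{Conf}(E)}\ \prod_{x\in X}g(x)\,d\mathbb P_K(X)=\det\bigl(1+(g-1)K\chi_B\bigr)$$ (Fredholm determinant, the integrand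 being integrable) for every bounded Borel set $B$ and every bounded measurable $g:E\to\mathbb C$ with $g=1$ outside $B$. For a topological space $X$ let $\mathcal M_{\mathrm{fin}}(X)$ be the space of finite Borel measures on $X$, with the weak topology and its Borel $\sigma$-algebra. For $f:E\to[0,\infty)$ put $\mathrm{Conf}_f(E)=\{X\in\mathrm{Conf}(E):\sum_{x\in X}f(x)<\infty\}$ and $\sigma_f:\mathrm{Conf}_f(E)\to\mathcal M_{\mathrm{fin}}(E)$, $\sigma_f(X)=\sum_{x\in X}f(x)\delta_x$ (set $\sigma_f=0$ outside $\mathrm{Conf}_f(E)$). **Proposition.** Let $f$ be a nonnegative continuous function on $E$. Let $K_n$ ($n\in\mathbb N$) and $K$ in $\mathscr I_{1,\mathrm{loc}}(E,\mu)$ be self-adjoint positive contractions, inducing determinantal measures $\mathbb P_{K_n}$, $\mathbb P_K$, such that $K_n\to K$ in $\mathscr I_{1,\mathrm{loc}}(E,\mu)$ as $n\to\infty$. Assume additionally that the operators $\sqrt fK_n\sqrt f$ and $\sqrt fK\sqrt f$, defined on $\{\varphi\in L_2(E,\mu):\sqrt f\varphi\in L_2(E,\mu)\}$, extend to trace class operators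 on $L_2(E,\mu)$ and that $$\sqrt fK_n\sqrt f\to\sqrt fK\sqrt f\quad\text{in }\mathscr I_1(E,\mu)\text{ as }n\to\infty.$$ Then $\sigma_f$ is Borel measurable, $\mathbb P_{K_n}(\mathrm{Conf}_f(E))=1$ for all $n$, $\mathbb P_K(\mathrm{Conf}_f(E))=1$, and $$(\sigma_f)_*\mathbb P_{K_n}\to(\sigma_f)_*\mathbb P_K$$ weakly in $\mathcal M_{\mathrm{fin}}(\mathcal M_{\mathrm{fin}}(E))$ as $n\to\infty$. -/

import Mathlib

open MeasureTheory Filter Topology Set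
open scoped ENNReal NNReal InnerProductSpace ComplexOrder

noncomputable section

/-! ### Trace class operators and Fredholm determinants on a complex Hilbert space -/

section TraceClass

variable {H : Type*} [NormedAddCommGroup H] [InnerProductSpace ℂ H] [CompleteSpace H]

variable (H) in
/-- The index set of a fixed orthonormal Hilbert basis of `H`. -/
def basisIndex : Set H := (exists_hilbertBasis ℂ H).choose

variable (H) in
/-- A fixed orthonormal Hilbert basis of `H`. The trace norm and the Fredholm determinant (of a
trace class operator) below do not depend on which one is used. -/
def stdBasis : HilbertBasis (basisIndex H) ℂ H := (exists_hilbertBasis ℂ H).choose_spec.choose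

/-- The trace norm `‖A‖₁ = tr |A| = ∑ᵢ ⟪eᵢ, |A| eᵢ⟫`, where `|A| = √(A* A)`, as an extended
nonnegative real. -/
def traceNorm (A : H →L[ℂ] H) : ℝ≥0∞ :=
  ∑' i, ENNReal.ofReal (⟪stdBasis H i, CFC.abs A (stdBasis H i)⟫_ℂ).re

/-- `A` belongs to the ideal `ℐ₁` of trace class operators. -/
def IsTraceClass (A : H →L[ℂ] H) : Prop := traceNorm A < ∞

open Classical in
/-- The Fredholm determinant `det (1 + A) = ∑ₖ tr (Λᵏ A)` of a trace class operator `A`. The trace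
of `Λᵏ A` is written in the basis `e_{i₁} ∧ ⋯ ∧ e_{iₖ}`, so that the sum is over all principal minors
`det (⟪eᵢ, A eⱼ⟫)` with `i, j` in a finite set `F` of indices. For `A` of trace class the sum is
absolutely convergent. -/
def fredholmDet (A : H →L[ℂ] H) : ℂ :=
  ∑' F : Finset (basisIndex H),
    Matrix.det (Matrix.of fun i j : F => ⟪stdBasis H i.1, A (stdBasis H j.1)⟫_ℂ)

end TraceClass

/-! ### Operators on `L₂(E, μ)` -/

section L2

variable {E : Type*} [MeasurableSpace E]

/-- The complex Hilbert space `L₂(E, μ)`. -/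
abbrev L2 (μ : Measure E) : Type _ := Lp ℂ 2 μ

open Classical in
/-- Multiplication by the (essentially) bounded measurable function `h`, as a bounded operator of
`L₂(E, μ)`. (Set to zero if `h` is not in `L_∞`; it is only used for bounded measurable `h`.) -/
def mulOp (μ : Measure E) (h : E → ℂ) : L2 μ →L[ℂ] L2 μ :=
  if hh : MemLp h ∞ μ then (ContinuousLinearMap.mul ℂ ℂ).holderL μ ∞ 2 2 (hh.toLp h) else 0

/-- Multiplication by the indicator function `χ_B`. -/
def chiOp (μ : Measure E) (B : Set E) : L2 μ →L[ℂ] L2 μ := mulOp μ (B.indicator fun _ => 1)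

/-- `T` is the operator `w K w`, for a nonnegative, possibly unbounded, finite function `w`:
`T φ = w · K (w φ)` for every `φ` in the (dense) domain `{φ ∈ L₂ : w φ ∈ L₂}` of the operator of
multiplication by `w`; in particular the bounded operator `T` is determined by `K` and `w`. -/
def IsWeighted {μ : Measure E} (w : E → ℝ≥0) (K T : L2 μ →L[ℂ] L2 μ) : Prop :=
  ∀ φ ψ : L2 μ, (ψ =ᵐ[μ] fun x => ((w x : ℝ) : ℂ) * φ x) →
    T φ =ᵐ[μ] fun x => ((w x : ℝ) : ℂ) * K ψ x

variable [Bornology E]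

/-- `K ∈ ℐ_{1,loc}(E, μ)`: the operator `χ_B K χ_B` is of trace class for every bounded Borel `B`. -/
def IsLocTraceClass {μ : Measure E} (K : L2 μ →L[ℂ] L2 μ) : Prop :=
  ∀ B : Set E, Bornology.IsBounded B → MeasurableSet B →
    IsTraceClass (chiOp μ B ∘L K ∘L chiOp μ B)

/-- `K_n → K` in `ℐ_{1,loc}(E, μ)`: `‖χ_B (K_n - K) χ_B‖₁ → 0` for every bounded Borel `B`. -/
def TendstoLocTraceClass {μ : Measure E} (Kn : ℕ → L2 μ →L[ℂ] L2 μ) (K : L2 μ →L[ℂ] L2 μ) : Prop :=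
  ∀ B : Set E, Bornology.IsBounded B → MeasurableSet B →
    Tendsto (fun n => traceNorm (chiOp μ B ∘L (Kn n - K) ∘L chiOp μ B)) atTop (𝓝 0)

end L2

/-! ### Configurations and determinantal measures -/

/-- A configuration on `E`: a collection of points, without regard to order, of which only finitely
many lie in any bounded set; `mult x` is the number of particles at the point `x`. -/
structure Conf (E : Type*) [Bornology E] where
  mult : E → ℕ
  finite_inter : ∀ B : Set E, Bornology.IsBounded B → (Function.support mult ∩ B).Finite

namespace Conf

variable {E : Type*} [Bornology E]

/-- `#_B(X)`, the number of particles in the bounded set `B`. -/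
def count (B : Set E) (X : Conf E) : ℕ := ∑ᶠ x ∈ B, X.mult x

/-- The Borel sigma-algebra of `Conf(E)`, generated by the functions `#_B`, `B` bounded Borel. -/
instance [MeasurableSpace E] : MeasurableSpace (Conf E) :=
  ⨆ B : {B : Set E // Bornology.IsBounded B ∧ MeasurableSet B},
    MeasurableSpace.comap (count B.1) ⊤

/-- The multiplicative functional `Ψ_g(X) = ∏_{x ∈ X} g(x)`. -/
def mulFunctional (g : E → ℂ) (X : Conf E) : ℂ := ∏ᶠ x, g x ^ X.mult x

end Conf

/-- `P = P_K` is the determinantal measure induced by `K`: for every bounded measurable `g` such that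
`g - 1` is supported in a bounded Borel set `B`, one has `E_P Ψ_g = det (1 + (g - 1) K χ_B)`. -/
def IsDeterminantal {E : Type*} [MeasurableSpace E] [Bornology E] {μ : Measure E}
    (K : L2 μ →L[ℂ] L2 μ) (P : ProbabilityMeasure (Conf E)) : Prop :=
  ∀ (g : E → ℂ) (B : Set E), Measurable g → (∃ C : ℝ, ∀ x, ‖g x‖ ≤ C) →
    Bornology.IsBounded B → MeasurableSet B → (∀ x ∉ B, g x = 1) →
      Integrable (Conf.mulFunctional g) (P : Measure (Conf E)) ∧
      ∫ X, Conf.mulFunctional g X ∂(P : Measure (Conf E)) =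
        fredholmDet (mulOp μ (fun x => g x - 1) ∘L K ∘L chiOp μ B)

/-! ### Spaces of finite measures and the map `σ_f` -/

/-- The space of finite (Borel) measures on `X`. With the weak topology and the Borel sigma-algebra
of the weak topology it is again a topological measurable space, so that `MFin (MFin X)` makes
sense. -/
def MFin (X : Type*) [MeasurableSpace X] : Type _ := FiniteMeasure X

section MFin

variable {X : Type*} [MeasurableSpace X]

/-- The weak topology. -/
instance [TopologicalSpace X] [OpensMeasurableSpace X] : TopologicalSpace (MFin X) :=
  inferInstanceAs (TopologicalSpace (FiniteMeasure X))

/-- The Borel sigma-algebra of the weak topology. -/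
instance [TopologicalSpace X] [OpensMeasurableSpace X] : MeasurableSpace (MFin X) :=
  borel (MFin X)

instance [TopologicalSpace X] [OpensMeasurableSpace X] : BorelSpace (MFin X) := ⟨rfl⟩

/-- The push-forward `s_* P` of a probability measure `P`, as an element of `MFin X`; it is used
together with the measurability of `s`. -/
def pushMFin {Ω : Type*} [MeasurableSpace Ω] (s : Ω → X) (P : ProbabilityMeasure Ω) : MFin X :=
  P.toFiniteMeasure.map s

end MFin

section Sigma

variable {E : Type*} [MeasurableSpace E] [Bornology E]

/-- `Conf_f(E)`, the set of configurations `X` with `∑_{x ∈ X} f(x) < ∞`. -/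
def confF (f : E → ℝ≥0) : Set (Conf E) :=
  {X | ∑' x, (X.mult x : ℝ≥0∞) * (f x : ℝ≥0∞) < ∞}

/-- The measure `∑_{x ∈ X} f(x) δ_x`. -/
def sigmaMeasure (f : E → ℝ≥0) (X : Conf E) : Measure E :=
  Measure.sum fun x => ((X.mult x : ℝ≥0∞) * (f x : ℝ≥0∞)) • Measure.dirac x

theorem isFiniteMeasure_sigmaMeasure {f : E → ℝ≥0} {X : Conf E} (hX : X ∈ confF f) :
    IsFiniteMeasure (sigmaMeasure f X) := by
  constructor
  have h : sigmaMeasure f X univ = ∑' x, (X.mult x : ℝ≥0∞) * (f x : ℝ≥0∞) := by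
    simp [sigmaMeasure, Measure.sum_apply _ MeasurableSet.univ]
  rw [h]
  exact hX

open Classical in
/-- The map `σ_f : Conf_f(E) → M_fin(E)`, `σ_f(X) = ∑_{x ∈ X} f(x) δ_x`, extended by the zero measure
outside of `Conf_f(E)`. -/
def sigmaMap (f : E → ℝ≥0) (X : Conf E) : MFin E :=
  if hX : X ∈ confF f then
    (⟨sigmaMeasure f X, isFiniteMeasure_sigmaMeasure hX⟩ : FiniteMeasure E)
  else (0 : FiniteMeasure E)

end Sigma

end

/-! The weak topology of `MFin E` is induced by countably many real coordinates, the integrals of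
test functions (`isInducing_testCoord`). Weak convergence of laws on such a space follows from
Lévy's theorem applied to finitely many coordinates at a time
(`ProbabilityMeasure.tendsto_of_isInducing`). Hence it suffices to show that the expectation of `exp
(i ∑_{x ∈ X} f(x) φ(x))` under `P_{K_n}` tends to that under `P_K`, for φ a finite linear
combination of test functions.

If the sum is cut down to a bounded set `A`, the exponential becomes a multiplicative functional and
its expectation a Fredholm determinant. This converges by local trace norm convergence and
`tendsto_fredholmDet`: by positivity the principal minors are determinants of inner products, so
Hadamard's inequality gives a summable majorant.

The cut costs at most `sup |φ|` times the expectation of `∑_{x ∈ X \ A} f(x)`. By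
`IsDeterminantal.lintegral_le` that expectation is at most `tr (χ √f K √f χ)`, where χ is the
indicator of the complement of `A`; the bound comes from the first order expansion of `det (1 - s f
K χ)` at `s = 0` and Fatou's lemma. The tails of `√f K √f` vanish along an exhaustion, and those of
`√f K_n √f` exceed them by at most the trace norm of the difference (`hsSq_sqrtAbs_comp_le_add`), so
the cut is harmless uniformly for large `n`. With `A` empty the same bound shows that almost every
configuration lies in `confF f`. -/

noncomputable section

/-! ### Hadamard's inequality for matrices of inner products. -/

section Hadamard

variable {V : Type*} [NormedAddCommGroup V] [InnerProductSpace ℂ V]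

/-- **Hadamard's inequality**: the determinant of a family of vectors with respect to an
orthonormal basis is at most the product of their norms. -/
theorem OrthonormalBasis.norm_det_le {n : ℕ} (b : OrthonormalBasis (Fin n) ℂ V) (v : Fin n → V) :
    ‖b.toBasis.det v‖ ≤ ∏ i, ‖v i‖ := by
  have : FiniteDimensional ℂ V := b.toBasis.finiteDimensional_of_finite
  have hd : Module.finrank ℂ V = Fintype.card (Fin n) := Module.finrank_eq_card_basis b.toBasis
  set c := InnerProductSpace.gramSchmidtOrthonormalBasis hd v with hc
  have h1 : b.toBasis.det v = b.toBasis.det c * c.toBasis.det v := by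
    simp only [Module.Basis.det_apply]
    rw [← Matrix.det_mul, ← c.coe_toBasis, Module.Basis.toMatrix_mul_toMatrix]
  rw [h1, norm_mul, OrthonormalBasis.det_to_matrix_orthonormalBasis, one_mul,
    hc, InnerProductSpace.gramSchmidtOrthonormalBasis_det, norm_prod]
  refine Finset.prod_le_prod (fun _ _ => norm_nonneg _) fun i _ => ?_
  refine (norm_inner_le_norm _ _).trans ?_
  rw [OrthonormalBasis.norm_eq_one, one_mul]

theorem norm_det_inner_le_fin {n : ℕ} (u v : Fin n → V) :
    ‖(Matrix.of fun i j => ⟪u i, v j⟫_ℂ).det‖ ≤ ∏ i, ‖u i‖ * ‖v i‖ := by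
  by_cases hv : LinearIndependent ℂ v
  · set S := Submodule.span ℂ (range v)
    have : FiniteDimensional ℂ S := FiniteDimensional.span_of_finite ℂ (finite_range v)
    have hd : Module.finrank ℂ S = Fintype.card (Fin n) := finrank_span_eq_card hv
    let b : OrthonormalBasis (Fin n) ℂ S :=
      (stdOrthonormalBasis ℂ S).reindex (finCongr (by simpa using hd))
    let w : Fin n → S := fun i => ⟨v i, Submodule.subset_span (mem_range_self i)⟩
    let p : Fin n → S := fun i => S.orthogonalProjectionOnto (u i)
    -- Projecting `u` onto the span of `v` does not change the inner products. By independence of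
    -- `v` both coordinate matrices are square, so the determinant factors.
    have h1 : (Matrix.of fun i j => ⟪u i, v j⟫_ℂ)
        = (b.toBasis.toMatrix p).conjTranspose * b.toBasis.toMatrix w := by
      ext i j
      have : ⟪u i, v j⟫_ℂ = ⟪p i, w j⟫_ℂ := by
        simp [p, w]
      rw [Matrix.of_apply, this, ← b.sum_inner_mul_inner]
      simp [Matrix.mul_apply, Module.Basis.toMatrix_apply, b.repr_apply_apply]
    rw [h1, Matrix.det_mul, Matrix.det_conjTranspose, norm_mul, norm_star, Finset.prod_mul_distrib]
    refine mul_le_mul ((b.norm_det_le p).trans ?_) ((b.norm_det_le w).trans ?_)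
      (norm_nonneg _) (Finset.prod_nonneg fun _ _ => norm_nonneg _)
    · exact Finset.prod_le_prod (fun _ _ => norm_nonneg _)
        fun i _ => Submodule.norm_orthogonalProjectionOnto_apply_le S (u i)
    · exact le_of_eq rfl
  · obtain ⟨g, hg, i, hi⟩ := Fintype.not_linearIndependent_iff.1 hv
    have : (Matrix.of fun i j => ⟪u i, v j⟫_ℂ).det = 0 := by
      refine Matrix.exists_mulVec_eq_zero_iff.1 ⟨g, fun h => hi (by simp [h]), ?_⟩
      ext k
      have := congrArg (fun x => ⟪u k, x⟫_ℂ) hg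
      simpa [inner_sum, inner_smul_right, Matrix.mulVec, dotProduct, mul_comm] using this
    rw [this, norm_zero]
    positivity

/-- Hadamard's inequality for the matrix of inner products of two families of vectors. -/
theorem norm_det_inner_le {ι : Type*} [Fintype ι] [DecidableEq ι] (u v : ι → V) :
    ‖(Matrix.of fun i j => ⟪u i, v j⟫_ℂ).det‖ ≤ ∏ i, ‖u i‖ * ‖v i‖ := by
  let e := (Fintype.equivFin ι).symm
  have := norm_det_inner_le_fin (u ∘ e) (v ∘ e)
  rw [← Matrix.det_submatrix_equiv_self e, ← e.prod_comp]
  exact this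

end Hadamard

/-! ### Hilbert–Schmidt norms, trace norms and traces of products. -/

section HilbertSchmidt

variable {H : Type*} [NormedAddCommGroup H] [InnerProductSpace ℂ H] [CompleteSpace H]

/-- The square of the Hilbert–Schmidt norm. -/
def hsSq (A : H →L[ℂ] H) : ℝ≥0∞ := ∑' i, ‖A (stdBasis H i)‖ₑ ^ 2

theorem tsum_enorm_inner_sq (x : H) :
    ∑' i, ‖⟪stdBasis H i, x⟫_ℂ‖ₑ ^ 2 = ‖x‖ₑ ^ 2 := by
  have h := (stdBasis H).hasSum_inner_mul_inner x x
  have h2 : HasSum (fun i => ‖⟪stdBasis H i, x⟫_ℂ‖ ^ 2) (‖x‖ ^ 2) := by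
    have h3 := Complex.hasSum_re h
    convert h3 using 1
    · ext i
      rw [← inner_conj_symm x, Complex.conj_mul']
      norm_cast
    · rw [inner_self_eq_norm_sq_to_K]; norm_cast
  have h4 := ENNReal.ofReal_tsum_of_nonneg (fun i => by positivity) h2.summable
  rw [h2.tsum_eq] at h4
  simpa [ENNReal.ofReal_pow, ofReal_norm] using h4.symm

/-- By Parseval both sides are the double sum of `|⟪eⱼ, A eᵢ⟫|²`, up to the order of summation. -/
theorem hsSq_adjoint (A : H →L[ℂ] H) : hsSq A.adjoint = hsSq A := by
  unfold hsSq
  rw [tsum_congr fun i => (tsum_enorm_inner_sq (A.adjoint (stdBasis H i))).symm,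
    tsum_congr fun i => (tsum_enorm_inner_sq (A (stdBasis H i))).symm, ENNReal.tsum_comm]
  refine tsum_congr fun i => tsum_congr fun j => ?_
  rw [ContinuousLinearMap.adjoint_inner_right, ← ofReal_norm, norm_inner_symm, ofReal_norm]

theorem hsSq_comp_le_left (A B : H →L[ℂ] H) : hsSq (A ∘L B) ≤ ‖A‖ₑ ^ 2 * hsSq B := by
  unfold hsSq
  rw [← ENNReal.tsum_mul_left]
  refine ENNReal.tsum_le_tsum fun i => ?_
  rw [← mul_pow]
  gcongr
  exact A.le_opENorm _

theorem hsSq_comp_le_right (A B : H →L[ℂ] H) : hsSq (A ∘L B) ≤ hsSq A * ‖B‖ₑ ^ 2 := by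
  rw [← hsSq_adjoint, ContinuousLinearMap.adjoint_comp, ← hsSq_adjoint A, mul_comm]
  refine (hsSq_comp_le_left _ _).trans_eq ?_
  congr 2
  simp [enorm_eq_nnnorm]

theorem enorm_sq_le_hsSq (A : H →L[ℂ] H) (x : H) : ‖A x‖ₑ ^ 2 ≤ hsSq A * ‖x‖ₑ ^ 2 := by
  rw [← tsum_enorm_inner_sq, ← hsSq_adjoint, hsSq, ← ENNReal.tsum_mul_right]
  refine ENNReal.tsum_le_tsum fun i => ?_
  rw [← mul_pow, ← ContinuousLinearMap.adjoint_inner_left]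
  gcongr
  simp only [enorm_eq_nnnorm]
  exact_mod_cast nnnorm_inner_le_nnnorm (𝕜 := ℂ) _ _

/-- The square root of `|A|`. -/
def sqrtAbs (A : H →L[ℂ] H) : H →L[ℂ] H := CFC.sqrt (CFC.abs A)

theorem isSelfAdjoint_sqrtAbs (A : H →L[ℂ] H) : IsSelfAdjoint (sqrtAbs A) :=
  (CFC.sqrt_nonneg _).isSelfAdjoint

theorem adjoint_sqrtAbs (A : H →L[ℂ] H) : (sqrtAbs A).adjoint = sqrtAbs A :=
  (isSelfAdjoint_sqrtAbs A).adjoint_eq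

theorem sqrtAbs_comp_sqrtAbs (A : H →L[ℂ] H) : sqrtAbs A ∘L sqrtAbs A = CFC.abs A :=
  CFC.sqrt_mul_sqrt_self _ (CFC.abs_nonneg _)

theorem inner_abs (A : H →L[ℂ] H) (x y : H) :
    ⟪x, CFC.abs A y⟫_ℂ = ⟪sqrtAbs A x, sqrtAbs A y⟫_ℂ := by
  rw [← sqrtAbs_comp_sqrtAbs, ContinuousLinearMap.comp_apply,
    ← ContinuousLinearMap.adjoint_inner_left, adjoint_sqrtAbs]

/-- This reduces trace norm estimates to Hilbert–Schmidt ones, which need only Parseval. -/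
theorem traceNorm_eq_hsSq (A : H →L[ℂ] H) : traceNorm A = hsSq (sqrtAbs A) := by
  unfold traceNorm hsSq
  refine tsum_congr fun i => ?_
  rw [inner_abs, inner_self_eq_norm_sq_to_K, ← ofReal_norm,
    ← ENNReal.ofReal_pow (norm_nonneg _)]
  norm_cast

theorem ContinuousLinearMap.IsPositive.abs_eq {A : H →L[ℂ] H} (hA : A.IsPositive) :
    CFC.abs A = A :=
  CFC.abs_of_nonneg A ((ContinuousLinearMap.nonneg_iff_isPositive A).2 hA)

theorem ContinuousLinearMap.IsPositive.inner_eq {A : H →L[ℂ] H} (hA : A.IsPositive) (x y : H) :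
    ⟪x, A y⟫_ℂ = ⟪sqrtAbs A x, sqrtAbs A y⟫_ℂ := by
  rw [← inner_abs, hA.abs_eq]

/-- `|D| - D` and `|D| + D` are twice the negative and the positive part of `D`, so `±D ≤ |D|` as
quadratic forms. -/
theorem norm_inner_le_sqrtAbs {D : H →L[ℂ] H} (hD : IsSelfAdjoint D) (x : H) :
    |(⟪x, D x⟫_ℂ).re| ≤ ‖sqrtAbs D x‖ ^ 2 := by
  have h1 : (⟪x, CFC.abs D x⟫_ℂ).re = ‖sqrtAbs D x‖ ^ 2 := by
    rw [inner_abs, inner_self_eq_norm_sq_to_K]; norm_cast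
  have h2 : 0 ≤ CFC.abs D - D := by
    rw [CFC.abs_sub_self D hD]
    exact smul_nonneg (by norm_num) (CFC.negPart_nonneg D)
  have h3 : 0 ≤ CFC.abs D + D := by
    rw [CFC.abs_add_self D hD]
    exact smul_nonneg (by norm_num) (CFC.posPart_nonneg D)
  have h2' := ((ContinuousLinearMap.nonneg_iff_isPositive _).1 h2).re_inner_nonneg_right x
  have h3' := ((ContinuousLinearMap.nonneg_iff_isPositive _).1 h3).re_inner_nonneg_right x
  simp [inner_sub_right, inner_add_right] at h2' h3'
  rw [abs_le]
  constructor <;> linarith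

/-- `‖D‖ = ‖|D|‖ ≤ ‖S‖²` for `S = √|D|`, and the operator norm of `S` is at most its Hilbert–Schmidt
norm. -/
theorem enorm_le_traceNorm (D : H →L[ℂ] H) : ‖D‖ₑ ≤ traceNorm D := by
  by_cases hfin : hsSq (sqrtAbs D) = ∞
  · rw [traceNorm_eq_hsSq, hfin]; exact le_top
  have h1 : ‖D‖ = ‖sqrtAbs D ∘L sqrtAbs D‖ := by rw [sqrtAbs_comp_sqrtAbs, CFC.norm_abs]
  have h2 : ‖sqrtAbs D‖ ≤ √(hsSq (sqrtAbs D)).toReal := by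
    refine ContinuousLinearMap.opNorm_le_bound _ (Real.sqrt_nonneg _) fun x => ?_
    refine Real.le_sqrt_of_sq_le ?_ |>.trans_eq
      (Real.sqrt_mul ENNReal.toReal_nonneg (‖x‖ ^ 2)) |>.trans_eq
      (by rw [Real.sqrt_sq (norm_nonneg _)])
    have := ENNReal.toReal_mono (ENNReal.mul_ne_top hfin (by simp)) (enorm_sq_le_hsSq (sqrtAbs D) x)
    simpa using this
  have h3 : ‖D‖ ≤ (hsSq (sqrtAbs D)).toReal := by
    rw [h1]
    refine (ContinuousLinearMap.opNorm_comp_le _ _).trans ?_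
    calc _ ≤ √(hsSq (sqrtAbs D)).toReal * √(hsSq (sqrtAbs D)).toReal := by gcongr
      _ = _ := Real.mul_self_sqrt ENNReal.toReal_nonneg
  rw [traceNorm_eq_hsSq, ← ofReal_norm]
  exact ENNReal.ofReal_le_of_le_toReal h3

/-- `tr (X* Y) = tr (Y X*)` for Hilbert–Schmidt operators. -/
theorem tsum_inner_comm {X Y : H →L[ℂ] H} (hX : hsSq X ≠ ∞) (hY : hsSq Y ≠ ∞) :
    ∑' i, ⟪X (stdBasis H i), Y (stdBasis H i)⟫_ℂ =
      ∑' j, ⟪Y.adjoint (stdBasis H j), X.adjoint (stdBasis H j)⟫_ℂ := by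
  set e := stdBasis H
  let a : basisIndex H → basisIndex H → ℂ := fun i j => ⟪X (e i), e j⟫_ℂ * ⟪e j, Y (e i)⟫_ℂ
  have hs (Z : H →L[ℂ] H) : ∑' i, ∑' j, ‖⟪e j, Z (e i)⟫_ℂ‖ₑ ^ 2 = hsSq Z :=
    tsum_congr fun i => tsum_enorm_inner_sq _
  have hle (i j) : ‖a i j‖ₑ ≤ ‖⟪e j, X (e i)⟫_ℂ‖ₑ ^ 2 + ‖⟪e j, Y (e i)⟫_ℂ‖ₑ ^ 2 := by
    have h1 : ‖⟪X (e i), e j⟫_ℂ‖ = ‖⟪e j, X (e i)⟫_ℂ‖ := norm_inner_symm _ _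
    rw [← ofReal_norm, ← ofReal_norm, ← ofReal_norm, ← ENNReal.ofReal_pow (norm_nonneg _),
      ← ENNReal.ofReal_pow (norm_nonneg _), ← ENNReal.ofReal_add (by positivity) (by positivity),
      norm_mul, h1]
    exact ENNReal.ofReal_le_ofReal (by
      nlinarith [sq_nonneg (‖⟪e j, X (e i)⟫_ℂ‖ - ‖⟪e j, Y (e i)⟫_ℂ‖),
        norm_nonneg ⟪e j, X (e i)⟫_ℂ, norm_nonneg ⟪e j, Y (e i)⟫_ℂ])
  -- Absolute summability of the double family, from `hle`, justifies exchanging the two sums.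
  have hsum : Summable (Function.uncurry a) := by
    refine Summable.of_enorm ?_
    rw [ENNReal.tsum_prod']
    refine ne_top_of_le_ne_top (b := hsSq X + hsSq Y) (by simp [hX, hY]) ?_
    rw [← hs X, ← hs Y, ← ENNReal.tsum_add]
    refine ENNReal.tsum_le_tsum fun i => ?_
    rw [← ENNReal.tsum_add]
    exact ENNReal.tsum_le_tsum fun j => hle i j
  calc ∑' i, ⟪X (e i), Y (e i)⟫_ℂ = ∑' i, ∑' j, a i j :=
        tsum_congr fun i => (e.tsum_inner_mul_inner _ _).symm
    _ = ∑' j, ∑' i, a i j := hsum.tsum_comm.symm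
    _ = _ := by
        refine tsum_congr fun j => ?_
        rw [← e.tsum_inner_mul_inner]
        refine tsum_congr fun i => ?_
        simp only [a]
        rw [ContinuousLinearMap.adjoint_inner_left, ContinuousLinearMap.adjoint_inner_right,
          mul_comm]

/-- `tr (R² S²) = ‖S R‖₂²` for self-adjoint `R` and `S`, with `S` Hilbert–Schmidt. -/
theorem tsum_inner_comp_comp {R S : H →L[ℂ] H} (hR : R.adjoint = R) (hS : S.adjoint = S)
    (hfin : hsSq S ≠ ∞) :
    ∑' i, ⟪stdBasis H i, (R ∘L R) ((S ∘L S) (stdBasis H i))⟫_ℂ = ((hsSq (S ∘L R)).toReal : ℂ) := by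
  have hX : hsSq (S ∘L (R ∘L R)) ≠ ∞ :=
    ne_top_of_le_ne_top (ENNReal.mul_ne_top hfin (by simp)) (hsSq_comp_le_right S (R ∘L R))
  have h1 := tsum_inner_comm hX hfin
  have h2 : hsSq (S ∘L R) = hsSq (R ∘L S) := by
    rw [← hsSq_adjoint, ContinuousLinearMap.adjoint_comp, hR, hS]
  calc _ = ∑' i, ⟪(S ∘L (R ∘L R)) (stdBasis H i), S (stdBasis H i)⟫_ℂ := by
        refine tsum_congr fun i => ?_
        rw [← ContinuousLinearMap.adjoint_inner_right (S ∘L (R ∘L R))]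
        simp [ContinuousLinearMap.adjoint_comp, hR, hS]
    _ = _ := h1
    _ = ∑' j, ((‖(R ∘L S) (stdBasis H j)‖ ^ 2 : ℝ) : ℂ) := by
        refine tsum_congr fun j => ?_
        simp only [ContinuousLinearMap.adjoint_comp, hR, hS, ContinuousLinearMap.comp_apply]
        rw [← ContinuousLinearMap.adjoint_inner_left, hR, inner_self_eq_norm_sq_to_K]
        norm_cast
    _ = _ := by
        rw [← Complex.ofReal_tsum, h2, hsSq, ENNReal.tsum_toReal_eq fun _ => by simp]
        simp

end HilbertSchmidt

/-! ### Fredholm determinants: domination, continuity and first order expansion. -/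

section Fredholm

variable {H : Type*} [NormedAddCommGroup H] [InnerProductSpace ℂ H] [CompleteSpace H]

open Classical in
/-- The principal minor of the matrix of `A` on a finite set of basis vectors. -/
def principalMinor (A : H →L[ℂ] H) (F : Finset (basisIndex H)) : ℂ :=
  Matrix.det (Matrix.of fun i j : F => ⟪stdBasis H i.1, A (stdBasis H j.1)⟫_ℂ)

theorem fredholmDet_eq_tsum (A : H →L[ℂ] H) : fredholmDet A = ∑' F, principalMinor A F := rfl

theorem principalMinor_smul (c : ℂ) (A : H →L[ℂ] H) (F : Finset (basisIndex H)) :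
    principalMinor (c • A) F = c ^ F.card * principalMinor A F := by
  classical
  unfold principalMinor
  have := Matrix.det_smul
    (Matrix.of fun i j : F => ⟪stdBasis H i.1, A (stdBasis H j.1)⟫_ℂ) c
  rw [Fintype.card_coe] at this
  convert this using 2
  ext i j
  simp

theorem principalMinor_empty (A : H →L[ℂ] H) : principalMinor A ∅ = 1 := by
  simp [principalMinor]

theorem principalMinor_singleton (A : H →L[ℂ] H) (i : basisIndex H) :
    principalMinor A {i} = ⟪stdBasis H i, A (stdBasis H i)⟫_ℂ := by
  classical
  unfold principalMinor
  convert Matrix.det_unique (n := ({i} : Finset (basisIndex H))) _ using 1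
  simp

/-- The `i`-th factor of the Hadamard bound for the minors of `G M`, where `|M| = S²`. -/
def minorWeight (G S : H →L[ℂ] H) (i : basisIndex H) : ℝ≥0∞ :=
  ‖S (G.adjoint (stdBasis H i))‖ₑ ^ 2 + ‖S (stdBasis H i)‖ₑ ^ 2

theorem tsum_minorWeight_le (G S : H →L[ℂ] H) :
    ∑' i, minorWeight G S i ≤ hsSq S * (‖G‖ₑ ^ 2 + 1) := by
  unfold minorWeight
  rw [ENNReal.tsum_add, mul_add, mul_one]
  refine add_le_add ((hsSq_comp_le_right S G.adjoint).trans_eq ?_) le_rfl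
  congr 2
  simp [enorm_eq_nnnorm]

theorem norm_principalMinor_le {M : H →L[ℂ] H} (hM : M.IsPositive) (G : H →L[ℂ] H)
    {B : basisIndex H → ℝ≥0∞} (hB : ∀ i, B i ≠ ∞) (hle : ∀ i, minorWeight G (sqrtAbs M) i ≤ B i)
    (F : Finset (basisIndex H)) :
    ‖principalMinor (G ∘L M) F‖ ≤ ∏ i ∈ F, (B i).toReal := by
  classical
  set S := sqrtAbs M
  set e := stdBasis H
  -- With `M = S²` the entries `⟪eᵢ, G M eⱼ⟫` become `⟪S G* eᵢ, S eⱼ⟫`, the form to which Hadamard's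
  -- inequality applies. The products of norms are then bounded by sums of squares.
  have h1 : principalMinor (G ∘L M) F =
      (Matrix.of fun i j : F => ⟪S (G.adjoint (e i.1)), S (e j.1)⟫_ℂ).det := by
    unfold principalMinor
    congr 2
    ext i j
    rw [ContinuousLinearMap.comp_apply, ← ContinuousLinearMap.adjoint_inner_left, hM.inner_eq]
  rw [h1]
  refine (norm_det_inner_le _ _).trans ?_
  rw [← Finset.prod_coe_sort F fun i => (B i).toReal]
  refine Finset.prod_le_prod (fun _ _ => by positivity) fun i _ => ?_
  have h2 := ENNReal.toReal_mono (hB i) (hle i)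
  rw [minorWeight, ENNReal.toReal_add (by simp) (by simp)] at h2
  simp only [ENNReal.toReal_pow, toReal_enorm] at h2
  nlinarith [sq_nonneg (‖S (G.adjoint (e i.1))‖ - ‖S (e i.1)‖),
    norm_nonneg (S (G.adjoint (e i.1))), norm_nonneg (S (e i.1))]

theorem summable_prod_toReal {B : basisIndex H → ℝ≥0∞} (hB : ∑' i, B i ≠ ∞) :
    Summable fun F : Finset (basisIndex H) => ∏ i ∈ F, (B i).toReal :=
  summable_finsetProd_of_summable_nonneg (fun _ => ENNReal.toReal_nonneg)
    (ENNReal.summable_toReal hB)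

theorem tsum_minorWeight_ne_top {M : H →L[ℂ] H} (hT : IsTraceClass M) (G : H →L[ℂ] H) :
    ∑' i, minorWeight G (sqrtAbs M) i ≠ ∞ := by
  refine ne_top_of_le_ne_top ?_ (tsum_minorWeight_le _ _)
  rw [← traceNorm_eq_hsSq]
  exact ENNReal.mul_ne_top hT.ne (by simp)

theorem summable_norm_principalMinor {M : H →L[ℂ] H} (hM : M.IsPositive) (hT : IsTraceClass M)
    (G : H →L[ℂ] H) : Summable fun F => ‖principalMinor (G ∘L M) F‖ :=
  have h := tsum_minorWeight_ne_top hT G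
  (summable_prod_toReal h).of_nonneg_of_le (fun _ => norm_nonneg _)
    (norm_principalMinor_le hM G (ENNReal.ne_top_of_tsum_ne_top h) fun _ => le_rfl)

/-- `N = M + (N - M) ≤ M + |N - M|` as quadratic forms. This comparison avoids any continuity of the
square root. -/
theorem enorm_sqrtAbs_sq_le {M N : H →L[ℂ] H} (hM : M.IsPositive) (hN : N.IsPositive) (x : H) :
    ‖sqrtAbs N x‖ₑ ^ 2 ≤ ‖sqrtAbs M x‖ₑ ^ 2 + ‖sqrtAbs (N - M) x‖ₑ ^ 2 := by
  have hD : IsSelfAdjoint (N - M) := hN.isSelfAdjoint.sub hM.isSelfAdjoint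
  have key {A : H →L[ℂ] H} (hA : A.IsPositive) : (⟪x, A x⟫_ℂ).re = ‖sqrtAbs A x‖ ^ 2 := by
    rw [hA.inner_eq, inner_self_eq_norm_sq_to_K]; norm_cast
  have h := (abs_le.1 (norm_inner_le_sqrtAbs hD x)).2
  simp only [sub_apply, inner_sub_right, Complex.sub_re, key hM, key hN] at h
  simp only [← ofReal_norm, ← ENNReal.ofReal_pow (norm_nonneg _)]
  rw [← ENNReal.ofReal_add (by positivity) (by positivity)]
  exact ENNReal.ofReal_le_ofReal (by linarith)

theorem minorWeight_le_add {M N : H →L[ℂ] H} (hM : M.IsPositive) (hN : N.IsPositive)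
    (G : H →L[ℂ] H) (i : basisIndex H) :
    minorWeight G (sqrtAbs N) i ≤
      minorWeight G (sqrtAbs M) i + minorWeight G (sqrtAbs (N - M)) i := by
  unfold minorWeight
  refine (add_le_add (enorm_sqrtAbs_sq_le hM hN _) (enorm_sqrtAbs_sq_le hM hN _)).trans_eq ?_
  ring

theorem tendsto_principalMinor {A : ℕ → H →L[ℂ] H} {A₀ : H →L[ℂ] H}
    (h : Tendsto A atTop (𝓝 A₀)) (F : Finset (basisIndex H)) :
    Tendsto (fun n => principalMinor (A n) F) atTop (𝓝 (principalMinor A₀ F)) := by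
  classical
  have : Continuous fun A : H →L[ℂ] H => principalMinor A F := by
    unfold principalMinor
    refine Continuous.matrix_det ?_
    refine continuous_matrix fun i j => ?_
    simp only [Matrix.of_apply]
    fun_prop
  exact (this.tendsto A₀).comp h

theorem tendsto_of_traceNorm {M : ℕ → H →L[ℂ] H} {M₀ : H →L[ℂ] H}
    (h : Tendsto (fun n => traceNorm (M n - M₀)) atTop (𝓝 0)) : Tendsto M atTop (𝓝 M₀) := by
  rw [tendsto_iff_edist_tendsto_0]
  refine tendsto_of_tendsto_of_tendsto_of_le_of_le tendsto_const_nhds h (fun _ => zero_le) ?_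
  intro n
  simp only [edist_eq_enorm_sub]
  exact enorm_le_traceNorm _

/-- Summability of the trace norms puts the weights of all `M n` under one summable family `B`, so
dominated convergence applies to the sum over principal minors. -/
theorem tendsto_fredholmDet_of_summable {M : ℕ → H →L[ℂ] H} {M₀ : H →L[ℂ] H}
    (hM : ∀ n, (M n).IsPositive) (hM₀ : M₀.IsPositive) (hT : IsTraceClass M₀) (G : H →L[ℂ] H)
    (h : ∑' n, traceNorm (M n - M₀) ≠ ∞) :
    Tendsto (fun n => fredholmDet (G ∘L M n)) atTop (𝓝 (fredholmDet (G ∘L M₀))) := by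
  let B : basisIndex H → ℝ≥0∞ := fun i =>
    minorWeight G (sqrtAbs M₀) i + ∑' n, minorWeight G (sqrtAbs (M n - M₀)) i
  have hB : ∑' i, B i ≠ ∞ := by
    rw [ENNReal.tsum_add, ENNReal.tsum_comm]
    refine ENNReal.add_ne_top.2 ⟨tsum_minorWeight_ne_top hT G, ?_⟩
    refine ne_top_of_le_ne_top ?_ (ENNReal.tsum_le_tsum fun n => tsum_minorWeight_le G _)
    simp only [← traceNorm_eq_hsSq]
    rw [ENNReal.tsum_mul_right]
    exact ENNReal.mul_ne_top h (by simp)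
  have hlim : Tendsto (fun n => traceNorm (M n - M₀)) atTop (𝓝 0) :=
    ENNReal.tendsto_atTop_zero_of_tsum_ne_top h
  refine tendsto_tsum_of_dominated_convergence (summable_prod_toReal hB)
    (fun F => tendsto_principalMinor ?_ F) (Eventually.of_forall fun n F => ?_)
  · exact ((ContinuousLinearMap.compL ℂ H H H G).continuous.tendsto M₀).comp
      (tendsto_of_traceNorm hlim)
  · refine norm_principalMinor_le (hM n) G (ENNReal.ne_top_of_tsum_ne_top hB) (fun i => ?_) F
    refine (minorWeight_le_add hM₀ (hM n) G i).trans ?_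
    exact add_le_add le_rfl (ENNReal.le_tsum n)

/-- Continuity of the Fredholm determinant along `G Mₙ`, with `Mₙ` positive and convergent in the
trace norm. -/
theorem tendsto_fredholmDet {M : ℕ → H →L[ℂ] H} {M₀ : H →L[ℂ] H}
    (hM : ∀ n, (M n).IsPositive) (hM₀ : M₀.IsPositive) (hT : IsTraceClass M₀) (G : H →L[ℂ] H)
    (h : Tendsto (fun n => traceNorm (M n - M₀)) atTop (𝓝 0)) :
    Tendsto (fun n => fredholmDet (G ∘L M n)) atTop (𝓝 (fredholmDet (G ∘L M₀))) := by
  -- It is enough that every subsequence has a further one along which the determinants converge.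
  -- The further one is chosen with trace norms at most `2⁻ᵏ`, hence summable.
  refine tendsto_of_subseq_tendsto fun ns hns => ?_
  have h2 := h.comp hns
  have h3 (k : ℕ) : ∃ m, traceNorm (M (ns m) - M₀) ≤ (2⁻¹ : ℝ≥0∞) ^ k :=
    (h2.eventually (Iic_mem_nhds (ENNReal.pow_pos (by simp) k : (0 : ℝ≥0∞) < 2⁻¹ ^ k))).exists
  choose ms hms using h3
  refine ⟨ms, tendsto_fredholmDet_of_summable (fun n => hM _) hM₀ hT G ?_⟩
  refine ne_top_of_le_ne_top ?_ (ENNReal.tsum_le_tsum hms)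
  rw [ENNReal.tsum_geometric]
  simp

/-- First order expansion of the Fredholm determinant at the identity. -/
theorem norm_fredholmDet_sub_le {M : H →L[ℂ] H} (hM : M.IsPositive) (hT : IsTraceClass M)
    (G : H →L[ℂ] H) {s : ℝ} (hs0 : 0 ≤ s) (hs1 : s ≤ 1) :
    ‖fredholmDet ((-s : ℂ) • (G ∘L M)) -
        (1 - s * ∑' i, ⟪stdBasis H i, G (M (stdBasis H i))⟫_ℂ)‖ ≤
      s ^ 2 * ∑' F, ‖principalMinor (G ∘L M) F‖ := by
  classical
  set m := principalMinor (G ∘L M)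
  have hsum := summable_norm_principalMinor hM hT G
  have hinj : Function.Injective (fun i : basisIndex H => ({i} : Finset (basisIndex H))) :=
    Finset.singleton_injective
  -- `a` is the full expansion, `b` its degree 0 term and `c` the degree 1 terms without the factor
  -- `-s`. What remains has degree at least 2, where `s ^ card ≤ s ^ 2`.
  let a : Finset (basisIndex H) → ℂ := fun F => (-s : ℂ) ^ F.card * m F
  let b : Finset (basisIndex H) → ℂ := fun F => if F = ∅ then 1 else 0
  let c : Finset (basisIndex H) → ℂ := fun F => if F.card = 1 then m F else 0
  have ha : Summable a := by
    refine Summable.of_norm_bounded hsum fun F => ?_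
    simp only [a, norm_mul, norm_pow, norm_neg, Complex.norm_real, Real.norm_of_nonneg hs0]
    exact mul_le_of_le_one_left (norm_nonneg _) (pow_le_one₀ hs0 hs1)
  have hb : HasSum b 1 := hasSum_ite_eq ∅ 1
  have hc : Summable c := by
    refine Summable.of_norm_bounded hsum fun F => ?_
    simp only [c]
    split_ifs
    · exact le_rfl
    · simp
  have hct : ∑' F, c F = ∑' i, ⟪stdBasis H i, G (M (stdBasis H i))⟫_ℂ := by
    rw [← hinj.tsum_eq]
    · refine tsum_congr fun i => ?_
      simp only [c, Finset.card_singleton, if_true, m]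
      rw [principalMinor_singleton, ContinuousLinearMap.comp_apply]
    · intro F hF
      have : F.card = 1 := by
        by_contra h
        exact hF (by simp [c, h])
      obtain ⟨i, rfl⟩ := Finset.card_eq_one.1 this
      exact ⟨i, rfl⟩
  have hfd : fredholmDet ((-s : ℂ) • (G ∘L M)) = ∑' F, a F := by
    rw [fredholmDet_eq_tsum]
    exact tsum_congr fun F => principalMinor_smul _ _ _
  rw [hfd, ← hct]
  have hg := (ha.hasSum.sub (hb.sub (hc.hasSum.mul_left (s : ℂ))))
  rw [← hg.tsum_eq, ← tsum_mul_left]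
  refine tsum_of_norm_bounded (hsum.mul_left (s ^ 2)).hasSum fun F => ?_
  simp only [a, b, c]
  rcases Nat.lt_or_ge F.card 2 with h | h
  · interval_cases hF : F.card
    · obtain rfl := Finset.card_eq_zero.1 hF
      simp only [m, principalMinor_empty]
      simp
      positivity
    · have : F ≠ ∅ := by rintro rfl; simp at hF
      simp [this]
      positivity
  · have h0 : F ≠ ∅ := by rintro rfl; simp at h
    have h1 : F.card ≠ 1 := by omega
    simp only [h0, h1, if_false, mul_zero, sub_zero, norm_mul, norm_pow, norm_neg,
      Complex.norm_real, Real.norm_of_nonneg hs0]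
    exact mul_le_mul_of_nonneg_right (pow_le_pow_of_le_one hs0 hs1 h) (norm_nonneg _)

end Fredholm

/-! ### Compressions of positive operators and their tails. -/

section HilbertSchmidtPositive

variable {H : Type*} [NormedAddCommGroup H] [InnerProductSpace ℂ H] [CompleteSpace H]

/-- For positive `M`, the Hilbert–Schmidt norm of `√M R` only depends on `R* M R`. -/
theorem hsSq_sqrtAbs_comp {M : H →L[ℂ] H} (hM : M.IsPositive) (R : H →L[ℂ] H) :
    hsSq (sqrtAbs M ∘L R) = ∑' i, ENNReal.ofReal
      (⟪stdBasis H i, (R.adjoint ∘L M ∘L R) (stdBasis H i)⟫_ℂ).re := by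
  refine tsum_congr fun i => ?_
  simp only [ContinuousLinearMap.comp_apply]
  rw [ContinuousLinearMap.adjoint_inner_right, hM.inner_eq, inner_self_eq_norm_sq_to_K,
    ← ofReal_norm, ← ENNReal.ofReal_pow (norm_nonneg _)]
  norm_cast

/-- With `R` the indicator of the complement of a large set, this bounds the tails of `N` by those
of `M` uniformly in `R`. -/
theorem hsSq_sqrtAbs_comp_le_add {M N : H →L[ℂ] H} (hM : M.IsPositive) (hN : N.IsPositive)
    {R : H →L[ℂ] H} (hR : ‖R‖ ≤ 1) :
    hsSq (sqrtAbs N ∘L R) ≤ hsSq (sqrtAbs M ∘L R) + traceNorm (N - M) := by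
  calc hsSq (sqrtAbs N ∘L R) ≤ hsSq (sqrtAbs M ∘L R) + hsSq (sqrtAbs (N - M) ∘L R) := by
        unfold hsSq
        rw [← ENNReal.tsum_add]
        exact ENNReal.tsum_le_tsum fun i => enorm_sqrtAbs_sq_le hM hN _
    _ ≤ _ := by
        gcongr
        rw [traceNorm_eq_hsSq]
        refine (hsSq_comp_le_right _ _).trans (mul_le_of_le_one_right' ?_)
        refine pow_le_one' ?_ 2
        rw [← ofReal_norm]
        exact ENNReal.ofReal_le_one.2 hR

/-- If `Pₙ → 0` strongly and boundedly then `‖Pₙ S‖₂ → 0` for Hilbert–Schmidt `S`. -/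
theorem tendsto_hsSq_comp {P : ℕ → H →L[ℂ] H} {S : H →L[ℂ] H} (hS : hsSq S ≠ ∞)
    (hP : ∀ n, ‖P n‖ ≤ 1) (hlim : ∀ x, Tendsto (fun n => P n x) atTop (𝓝 0)) :
    Tendsto (fun n => hsSq (P n ∘L S)) atTop (𝓝 0) := by
  have hsum : Summable fun i => ‖S (stdBasis H i)‖ ^ 2 := by
    have := ENNReal.summable_toReal hS
    simpa using this
  have h1 (n) : hsSq (P n ∘L S) = ENNReal.ofReal (∑' i, ‖P n (S (stdBasis H i))‖ ^ 2) := by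
    have hle (i) : ‖P n (S (stdBasis H i))‖ ^ 2 ≤ ‖S (stdBasis H i)‖ ^ 2 := by
      gcongr
      exact (P n).le_of_opNorm_le (hP n) _ |>.trans_eq (one_mul _)
    rw [ENNReal.ofReal_tsum_of_nonneg (fun _ => by positivity)
      (hsum.of_nonneg_of_le (fun _ => by positivity) hle)]
    refine tsum_congr fun i => ?_
    rw [ENNReal.ofReal_pow (norm_nonneg _), ofReal_norm]
    rfl
  simp only [h1]
  rw [← ENNReal.ofReal_zero]
  refine ENNReal.tendsto_ofReal ?_
  rw [show (0 : ℝ) = ∑' _ : basisIndex H, (0 : ℝ) by simp]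
  refine tendsto_tsum_of_dominated_convergence hsum (fun i => ?_)
    (Eventually.of_forall fun n i => ?_)
  · have := (hlim (S (stdBasis H i))).norm.pow 2
    simpa using this
  · rw [Real.norm_of_nonneg (by positivity)]
    gcongr
    exact (P n).le_of_opNorm_le (hP n) _ |>.trans_eq (one_mul _)

end HilbertSchmidtPositive

/-! ### Multiplication operators on `L2 μ`. -/

section MulOp

variable {E : Type*} [MeasurableSpace E] {μ : Measure E}

theorem memLp_top_of_measurable {h : E → ℂ} (hm : Measurable h) (C : ℝ) (hC : ∀ x, ‖h x‖ ≤ C) :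
    MemLp h ∞ μ :=
  memLp_top_of_bound hm.aestronglyMeasurable C (Eventually.of_forall hC)

theorem mulOp_apply {h : E → ℂ} (hh : MemLp h ∞ μ) (φ : L2 μ) :
    mulOp μ h φ =ᵐ[μ] fun x => h x * φ x := by
  unfold mulOp
  rw [dif_pos hh]
  have h1 := (ContinuousLinearMap.mul ℂ ℂ).coeFn_holder (r := 2) (hh.toLp h) φ
  filter_upwards [h1, hh.coeFn_toLp] with x hx hx2
  have : ((ContinuousLinearMap.mul ℂ ℂ).holderL μ ∞ 2 2 (hh.toLp h)) φ =
    (ContinuousLinearMap.mul ℂ ℂ).holder 2 (hh.toLp h) φ := rfl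
  rw [this, hx, hx2]
  simp

theorem mulOp_adjoint {h : E → ℝ} (hh : MemLp (fun x => (h x : ℂ)) ∞ μ) :
    (mulOp μ fun x => (h x : ℂ)).adjoint = mulOp μ fun x => (h x : ℂ) := by
  symm
  rw [ContinuousLinearMap.eq_adjoint_iff]
  intro φ ψ
  rw [L2.inner_def, L2.inner_def]
  refine integral_congr_ae ?_
  filter_upwards [mulOp_apply hh φ, mulOp_apply hh ψ] with x h1 h2
  rw [h1, h2]
  simp
  ring

theorem memLp_indicator_one {B : Set E} (hB : MeasurableSet B) :
    MemLp (B.indicator fun _ => (1 : ℂ)) ∞ μ := by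
  refine memLp_top_of_measurable (measurable_const.indicator hB) 1 fun x => ?_
  by_cases hx : x ∈ B <;> simp [hx]

theorem chiOp_apply {B : Set E} (hB : MeasurableSet B) (φ : L2 μ) :
    chiOp μ B φ =ᵐ[μ] B.indicator φ := by
  filter_upwards [mulOp_apply (memLp_indicator_one hB) φ] with x hx
  rw [chiOp, hx]
  by_cases hx : x ∈ B <;> simp [hx]

theorem chiOp_adjoint {B : Set E} (hB : MeasurableSet B) :
    (chiOp μ B).adjoint = chiOp μ B := by
  have h : (B.indicator fun _ => (1 : ℂ)) = fun x => ((B.indicator (fun _ => (1 : ℝ)) x : ℝ) : ℂ) := by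
    ext x; by_cases hx : x ∈ B <;> simp [hx]
  have h2 := memLp_indicator_one (μ := μ) hB
  unfold chiOp
  rw [h] at h2 ⊢
  exact mulOp_adjoint h2

theorem chiOp_comp {A B : Set E} (hA : MeasurableSet A) (hB : MeasurableSet B) :
    chiOp μ A ∘L chiOp μ B = chiOp μ (A ∩ B) := by
  ext1 φ
  apply Lp.ext
  filter_upwards [chiOp_apply hA (chiOp μ B φ), chiOp_apply hB φ,
    chiOp_apply (hA.inter hB) φ] with x h1 h2 h3
  rw [ContinuousLinearMap.comp_apply, h1, h3]
  by_cases hx : x ∈ A <;> by_cases hx' : x ∈ B <;> simp [hx, hx', h2]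

theorem norm_chiOp_le {B : Set E} (hB : MeasurableSet B) : ‖chiOp μ B‖ ≤ 1 := by
  refine ContinuousLinearMap.opNorm_le_bound _ zero_le_one fun φ => ?_
  rw [one_mul]
  refine Lp.norm_le_norm_of_ae_le ?_
  filter_upwards [chiOp_apply hB φ] with x hx
  rw [hx]
  exact norm_indicator_le_norm_self _ _

theorem chiOp_compl_apply {B : Set E} (hB : MeasurableSet B) (φ : L2 μ) :
    chiOp μ Bᶜ φ = φ - chiOp μ B φ := by
  apply Lp.ext
  filter_upwards [chiOp_apply hB φ, chiOp_apply hB.compl φ, Lp.coeFn_sub φ (chiOp μ B φ)]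
    with x h1 h2 h3
  rw [h2, h3, Pi.sub_apply, h1]
  by_cases hx : x ∈ B <;> simp [hx]

theorem tendsto_chiOp_compl {A : ℕ → Set E} (hA : ∀ n, MeasurableSet (A n)) (hmono : Monotone A)
    (hU : ⋃ n, A n = univ) (φ : L2 μ) :
    Tendsto (fun n => chiOp μ (A n)ᶜ φ) atTop (𝓝 0) := by
  rw [tendsto_zero_iff_norm_tendsto_zero]
  have key : Tendsto (fun n => ⟪chiOp μ (A n)ᶜ φ, chiOp μ (A n)ᶜ φ⟫_ℂ) atTop (𝓝 0) := by
    simp only [L2.inner_def]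
    have h0 : (0 : ℂ) = ∫ _ : E, (0 : ℂ) ∂μ := by simp
    rw [h0]
    refine tendsto_integral_of_dominated_convergence (fun x => ‖⟪φ x, φ x⟫_ℂ‖)
      (fun n => (L2.integrable_inner _ _).aestronglyMeasurable) (L2.integrable_inner φ φ).norm
      (fun n => ?_) ?_
    · filter_upwards [chiOp_apply (hA n).compl φ] with x hx
      rw [hx]
      by_cases hx : x ∈ A n <;> simp [hx]
    · have : ∀ᵐ x ∂μ, ∀ n, chiOp μ (A n)ᶜ φ x = (A n)ᶜ.indicator φ x :=
        ae_all_iff.2 fun n => chiOp_apply (hA n).compl φ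
      filter_upwards [this] with x hx
      obtain ⟨m, hm⟩ := mem_iUnion.1 (hU ▸ mem_univ x : x ∈ ⋃ n, A n)
      refine tendsto_const_nhds.congr' ?_
      filter_upwards [eventually_ge_atTop m] with n hn
      rw [hx n]
      simp [hmono hn hm]
  have h2 : Tendsto (fun n => ‖chiOp μ (A n)ᶜ φ‖ ^ 2) atTop (𝓝 0) := by
    have := (Complex.continuous_re.tendsto 0).comp key
    refine this.congr fun n => ?_
    rw [Function.comp_apply, inner_self_eq_norm_sq_to_K]
    norm_cast
  have h3 := h2.sqrt
  simpa [Real.sqrt_sq] using h3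

theorem tendsto_chiOp {A : ℕ → Set E} (hA : ∀ n, MeasurableSet (A n)) (hmono : Monotone A)
    (hU : ⋃ n, A n = univ) (φ : L2 μ) :
    Tendsto (fun n => chiOp μ (A n) φ) atTop (𝓝 φ) := by
  have := (tendsto_const_nhds (x := φ)).sub (tendsto_chiOp_compl hA hmono hU φ)
  simpa [chiOp_compl_apply (hA _)] using this

end MulOp

/-! ### The operator `w K w` for unbounded `w`. -/

section Weighted

variable {E : Type*} [MeasurableSpace E] {μ : Measure E} {w : E → ℝ≥0} {K T : L2 μ →L[ℂ] L2 μ}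

/-- Multiplication by `w χ_A`. -/
def weightOp (μ : Measure E) (w : E → ℝ≥0) (A : Set E) : L2 μ →L[ℂ] L2 μ :=
  mulOp μ fun x => ((A.indicator (fun x => (w x : ℝ)) x : ℝ) : ℂ)

theorem memLp_weight (hw : Measurable w) {A : Set E} (hA : MeasurableSet A) {C : ℝ}
    (hC : ∀ x ∈ A, (w x : ℝ) ≤ C) :
    MemLp (fun x => ((A.indicator (fun x => (w x : ℝ)) x : ℝ) : ℂ)) ∞ μ := by
  refine memLp_top_of_measurable
    (Complex.measurable_ofReal.comp (hw.coe_nnreal_real.indicator hA)) (max C 0) fun x => ?_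
  by_cases hx : x ∈ A
  · simp [hx, hC x hx]
  · simp [hx]

theorem weightOp_adjoint (hw : Measurable w) {A : Set E} (hA : MeasurableSet A) {C : ℝ}
    (hC : ∀ x ∈ A, (w x : ℝ) ≤ C) : (weightOp μ w A).adjoint = weightOp μ w A :=
  mulOp_adjoint (memLp_weight hw hA hC)

/-- `χ_A T χ_A = (w χ_A) K (w χ_A)` if `w` is bounded on `A`. -/
theorem IsWeighted.chiOp_comp (h : IsWeighted w K T) (hw : Measurable w) {A : Set E}
    (hA : MeasurableSet A) {C : ℝ} (hC : ∀ x ∈ A, (w x : ℝ) ≤ C) :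
    chiOp μ A ∘L T ∘L chiOp μ A = weightOp μ w A ∘L K ∘L weightOp μ w A := by
  ext1 φ
  apply Lp.ext
  have hm := memLp_weight (μ := μ) hw hA hC
  have h1 : weightOp μ w A φ =ᵐ[μ] fun x => ((w x : ℝ) : ℂ) * chiOp μ A φ x := by
    filter_upwards [mulOp_apply hm φ, chiOp_apply hA φ] with x h1 h2
    rw [weightOp, h1, h2]
    by_cases hx : x ∈ A <;> simp [hx]
  filter_upwards [h _ _ h1, chiOp_apply hA (T (chiOp μ A φ)),
    mulOp_apply hm (K (weightOp μ w A φ))] with x h2 h3 h4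
  simp only [ContinuousLinearMap.comp_apply]
  refine h3.trans (Eq.trans ?_ h4.symm)
  by_cases hx : x ∈ A
  · simp [hx, h2]
  · simp [hx]

/-- An exhaustion of the space by sets on which `w` is bounded makes `w K w` positive if `K` is. -/
theorem IsWeighted.isPositive (h : IsWeighted w K T) (hw : Measurable w) (hK : K.IsPositive)
    {A : ℕ → Set E} (hA : ∀ n, MeasurableSet (A n)) (hmono : Monotone A)
    (hU : ⋃ n, A n = univ) (C : ℕ → ℝ) (hC : ∀ n, ∀ x ∈ A n, (w x : ℝ) ≤ C n) :
    T.IsPositive := by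
  rw [ContinuousLinearMap.isPositive_iff_complex]
  intro φ
  -- On functions supported in `A n` the weight is a bounded operator, so `T` is there a conjugate
  -- of `K` by a self-adjoint operator. Density and continuity then give all of `T`.
  have h1 (n : ℕ) : 0 ≤ ⟪T (chiOp μ (A n) φ), chiOp μ (A n) φ⟫_ℂ := by
    have h2 := (hK.conj_adjoint (weightOp μ w (A n)))
    rw [weightOp_adjoint hw (hA n) (hC n), ← h.chiOp_comp hw (hA n) (hC n)] at h2
    have h3 := h2.inner_nonneg_left φ
    rwa [ContinuousLinearMap.comp_apply, ContinuousLinearMap.comp_apply,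
      ← ContinuousLinearMap.adjoint_inner_right, chiOp_adjoint (hA n)] at h3
  have hlim := tendsto_chiOp hA hmono hU φ
  have h4 : 0 ≤ ⟪T φ, φ⟫_ℂ :=
    ge_of_tendsto' ((((T.continuous.tendsto φ).comp hlim).inner (𝕜 := ℂ) hlim)) h1
  rw [Complex.nonneg_iff] at h4
  refine ⟨?_, h4.1⟩
  apply Complex.ext
  · simp
  · simpa using h4.2

theorem IsTraceClass.hsSq_ne_top {H : Type*} [NormedAddCommGroup H] [InnerProductSpace ℂ H]
    [CompleteSpace H] {A : H →L[ℂ] H} (h : IsTraceClass A) : hsSq (sqrtAbs A) ≠ ∞ := by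
  rw [← traceNorm_eq_hsSq]
  exact h.ne

/-- `tr (w² χ_A K χ_A) = ‖√T χ_A‖₂²`. -/
theorem IsWeighted.tsum_inner (h : IsWeighted w K T) (hw : Measurable w) (hK : K.IsPositive)
    (hTpos : T.IsPositive) {A : Set E} (hA : MeasurableSet A)
    (hKA : IsTraceClass (chiOp μ A ∘L K ∘L chiOp μ A))
    {C : ℝ} (hC : ∀ x ∈ A, (w x : ℝ) ≤ C) :
    ∑' i, ⟪stdBasis (L2 μ) i, (weightOp μ w A ∘L weightOp μ w A)
        ((chiOp μ A ∘L K ∘L chiOp μ A) (stdBasis (L2 μ) i))⟫_ℂ =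
      ((hsSq (sqrtAbs T ∘L chiOp μ A)).toReal : ℂ) := by
  set M := chiOp μ A ∘L K ∘L chiOp μ A with hMdef
  have hM : M.IsPositive := by
    have := hK.conj_adjoint (chiOp μ A)
    rwa [chiOp_adjoint hA] at this
  have hm := memLp_weight (μ := μ) hw hA hC
  have hR := weightOp_adjoint (μ := μ) hw hA hC
  have h1 := tsum_inner_comp_comp hR (adjoint_sqrtAbs M) hKA.hsSq_ne_top
  rw [sqrtAbs_comp_sqrtAbs, hM.abs_eq] at h1
  -- Both Hilbert–Schmidt norms turn into the trace of the same operator `(w χ_A) K (w χ_A)`.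
  rw [h1, hsSq_sqrtAbs_comp hM, hsSq_sqrtAbs_comp hTpos, hR, chiOp_adjoint hA,
    h.chiOp_comp hw hA hC]
  have h2 : chiOp μ A ∘L weightOp μ w A = weightOp μ w A := by
    ext1 φ
    apply Lp.ext
    filter_upwards [chiOp_apply hA (weightOp μ w A φ), mulOp_apply hm φ] with x h2 h3
    rw [ContinuousLinearMap.comp_apply, h2]
    by_cases hx : x ∈ A
    · simp [hx]
    · simp [hx, weightOp, h3]
  have h3 : weightOp μ w A ∘L chiOp μ A = weightOp μ w A := by
    have := congrArg ContinuousLinearMap.adjoint h2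
    rwa [ContinuousLinearMap.adjoint_comp, hR, chiOp_adjoint hA] at this
  have h4 : weightOp μ w A ∘L M ∘L weightOp μ w A = weightOp μ w A ∘L K ∘L weightOp μ w A := by
    rw [hMdef, ContinuousLinearMap.comp_assoc, ContinuousLinearMap.comp_assoc, h2,
      ← ContinuousLinearMap.comp_assoc, h3]
  rw [h4]

/-- The tails of a trace class operator. -/
theorem tendsto_hsSq_chiOp_compl (hT : IsTraceClass T) {A : ℕ → Set E}
    (hA : ∀ n, MeasurableSet (A n)) (hmono : Monotone A) (hU : ⋃ n, A n = univ) :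
    Tendsto (fun n => hsSq (sqrtAbs T ∘L chiOp μ (A n)ᶜ)) atTop (𝓝 0) := by
  have := tendsto_hsSq_comp hT.hsSq_ne_top (fun n => norm_chiOp_le (μ := μ) (hA n).compl)
    (tendsto_chiOp_compl hA hmono hU)
  -- Strong convergence of the projections controls only products with the projection on the left;
  -- taking adjoints moves it to the right.
  refine this.congr fun n => ?_
  rw [← hsSq_adjoint, ContinuousLinearMap.adjoint_comp, adjoint_sqrtAbs,
    chiOp_adjoint (hA n).compl]

end Weighted

/-- An increasing sequence of bounded Borel sets covering the space, on each of which `f` is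
bounded. -/
structure IsExhaustion {E : Type*} [MeasurableSpace E] [Bornology E] (f : E → ℝ≥0)
    (A : ℕ → Set E) : Prop where
  measurableSet (n : ℕ) : MeasurableSet (A n)
  isBounded (n : ℕ) : Bornology.IsBounded (A n)
  monotone : Monotone A
  iUnion_eq : ⋃ n, A n = univ
  le (n : ℕ) (x : E) : x ∈ A n → f x ≤ n

theorem exists_isExhaustion {E : Type*} [MetricSpace E] [MeasurableSpace E] [OpensMeasurableSpace E]
    {f : E → ℝ≥0} (hf : Measurable f) : ∃ A, IsExhaustion f A := by
  rcases isEmpty_or_nonempty E with hE | ⟨⟨x₀⟩⟩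
  · exact ⟨fun _ => univ, fun _ => .univ, fun _ => (Set.toFinite _).isBounded, monotone_const,
      iUnion_const univ, fun _ x => isEmptyElim x⟩
  · refine ⟨fun n => Metric.ball x₀ n ∩ {x | f x ≤ n}, fun n => ?_, fun n => ?_, ?_, ?_, ?_⟩
    · exact Metric.isOpen_ball.measurableSet.inter (measurableSet_le hf measurable_const)
    · exact Metric.isBounded_ball.subset inter_subset_left
    · intro m n hmn x hx
      exact ⟨Metric.ball_subset_ball (by exact_mod_cast hmn) hx.1,
        le_trans (b := (m : ℝ≥0)) hx.2 (by exact_mod_cast hmn)⟩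
    · refine eq_univ_of_forall fun x => mem_iUnion.2 ?_
      obtain ⟨n, hn⟩ := exists_nat_gt (max (dist x x₀) (f x))
      refine ⟨n, (le_max_left _ _).trans_lt hn, ?_⟩
      have := ((le_max_right _ _).trans_lt hn).le
      exact_mod_cast this
    · exact fun n x hx => hx.2

/-! ### Configurations as counting measures. -/

namespace Conf

theorem mulFunctional_eq_prod {E : Type*} [Bornology E] (X : Conf E) {B : Set E}
    (hb : Bornology.IsBounded B) {g : E → ℂ}
    (hg : ∀ x ∉ B, g x = 1) :
    mulFunctional g X = ∏ x ∈ (X.finite_inter B hb).toFinset, g x ^ X.mult x := by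
  refine finprod_eq_prod_of_mulSupport_subset _ fun x hx => ?_
  rw [Function.mem_mulSupport] at hx
  simp only [Finite.coe_toFinset, mem_inter_iff, Function.mem_support]
  refine ⟨fun h => hx (by simp [h]), ?_⟩
  by_contra h
  exact hx (by simp [hg x h])

section Counting

variable {E : Type*} [MeasurableSpace E] [Bornology E]

/-- The counting measure `∑_{x ∈ X} δ_x` of a configuration. -/
def counting (X : Conf E) : Measure E :=
  Measure.sum fun x => (X.mult x : ℝ≥0∞) • Measure.dirac x

theorem lintegral_counting (X : Conf E) {h : E → ℝ≥0∞} (hh : Measurable h) :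
    ∫⁻ x, h x ∂X.counting = ∑' x, (X.mult x : ℝ≥0∞) * h x := by
  rw [counting, lintegral_sum_measure]
  refine tsum_congr fun x => ?_
  rw [lintegral_smul_measure, lintegral_dirac' _ hh, smul_eq_mul]

theorem counting_apply (X : Conf E) {B : Set E} (hB : MeasurableSet B)
    (hb : Bornology.IsBounded B) : X.counting B = (X.count B : ℝ≥0∞) := by
  have hfin : (Function.support (B.indicator X.mult)).Finite := by
    refine (X.finite_inter B hb).subset ?_
    rw [Set.support_indicator, inter_comm]
  rw [← lintegral_indicator_one hB, lintegral_counting X (measurable_one.indicator hB), count,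
    finsum_mem_def, ← Nat.coe_castAddMonoidHom, AddMonoidHom.map_finsum _ hfin,
    ← tsum_eq_finsum (L := SummationFilter.unconditional E)]
  · refine tsum_congr fun x => ?_
    by_cases hx : x ∈ B <;> simp [hx]
  · refine hfin.subset fun x hx => ?_
    contrapose! hx
    simp only [Function.mem_support, not_not] at hx ⊢
    simp [hx]

theorem measurable_count {B : Set E} (hB : MeasurableSet B) (hb : Bornology.IsBounded B) :
    Measurable (count B : Conf E → ℕ) := by
  refine Measurable.of_comap_le ?_
  exact le_iSup (fun B : {B : Set E // Bornology.IsBounded B ∧ MeasurableSet B} =>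
    MeasurableSpace.comap (count B.1) ⊤) ⟨B, hb, hB⟩

/-- The σ-algebra of `Conf E` only knows counts of bounded sets; the count of any Borel set is the
supremum of its counts along the exhaustion. -/
theorem measurable_counting {f : E → ℝ≥0} {A : ℕ → Set E} (hA : IsExhaustion f A) :
    Measurable (counting : Conf E → Measure E) := by
  refine Measure.measurable_of_measurable_coe _ fun B hB => ?_
  have h1 (X : Conf E) : X.counting B = ⨆ n, (X.count (B ∩ A n) : ℝ≥0∞) := by
    have hmono : Monotone fun n => B ∩ A n := fun m n hmn =>
      inter_subset_inter_right _ (hA.monotone hmn)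
    conv_lhs => rw [← inter_univ B, ← hA.iUnion_eq, inter_iUnion, hmono.measure_iUnion]
    exact iSup_congr fun n => X.counting_apply (hB.inter (hA.measurableSet n))
      ((hA.isBounded n).subset inter_subset_right)
  simp only [h1]
  refine Measurable.iSup fun n => ?_
  exact (Measurable.of_discrete (f := fun k : ℕ => (k : ℝ≥0∞))).comp
    (measurable_count (hB.inter (hA.measurableSet n))
      ((hA.isBounded n).subset inter_subset_right))

theorem measurable_lintegral_counting {f : E → ℝ≥0} {A : ℕ → Set E} (hA : IsExhaustion f A)
    {h : E → ℝ≥0∞} (hh : Measurable h) :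
    Measurable fun X : Conf E => ∫⁻ x, h x ∂X.counting :=
  (Measure.measurable_lintegral hh).comp (measurable_counting hA)

theorem measurable_setLIntegral_counting {f : E → ℝ≥0} {A : ℕ → Set E} (hA : IsExhaustion f A)
    {h : E → ℝ≥0∞} (hh : Measurable h) {B : Set E} (hB : MeasurableSet B) :
    Measurable fun X : Conf E => ∫⁻ x in B, h x ∂X.counting := by
  simp only [← lintegral_indicator hB]
  exact measurable_lintegral_counting hA (hh.indicator hB)

theorem mem_confF_iff {f : E → ℝ≥0} (hf : Measurable f) {X : Conf E} :
    X ∈ confF f ↔ ∫⁻ x, f x ∂X.counting < ∞ := by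
  rw [lintegral_counting X hf.coe_nnreal_ennreal]
  rfl

theorem setLIntegral_counting (X : Conf E) {B : Set E} (hB : MeasurableSet B)
    (hb : Bornology.IsBounded B) {h : E → ℝ≥0} (hh : Measurable h) :
    ∫⁻ x in B, h x ∂X.counting =
      ENNReal.ofReal (∑ x ∈ (X.finite_inter B hb).toFinset, X.mult x * (h x : ℝ)) := by
  rw [← lintegral_indicator hB, lintegral_counting X (hh.coe_nnreal_ennreal.indicator hB),
    tsum_eq_sum (s := (X.finite_inter B hb).toFinset),
    ENNReal.ofReal_sum_of_nonneg fun _ _ => by positivity]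
  · refine Finset.sum_congr rfl fun x hx => ?_
    have hx : x ∈ B := by simpa using (by simpa using hx : _ ∧ _).2
    rw [indicator_of_mem hx, ENNReal.ofReal_mul (by positivity), ENNReal.ofReal_natCast,
      ENNReal.ofReal_coe_nnreal]
  · intro x hx
    simp only [Finite.mem_toFinset, mem_inter_iff, Function.mem_support, not_and'] at hx
    by_cases hx' : x ∈ B
    · have := hx hx'
      simp only [not_not] at this
      simp [this]
    · simp [hx']

end Counting

end Conf

/-! ### The first moment bound. -/

section FirstMoment

variable {E : Type*} [MeasurableSpace E] [Bornology E] {μ : Measure E}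

/-- Each factor satisfies `0 ≤ 1 - s f(x) ≤ exp (-s f(x))`, so the product is at most the
exponential of the sum. The right side has a determinant as expectation. -/
theorem one_sub_exp_le_one_sub_re_mulFunctional {f : E → ℝ≥0} {A : Set E} (hf : Measurable f)
    (hA : MeasurableSet A) (hb : Bornology.IsBounded A) {s : ℝ}
    (hC : ∀ x ∈ A, s * f x ≤ 1) (X : Conf E) :
    1 - Real.exp (-s * (∫⁻ x in A, f x ∂X.counting).toReal) ≤
      1 - (Conf.mulFunctional (fun x => 1 - s * (A.indicator (fun x => (f x : ℝ)) x : ℂ)) X).re := by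
  rw [Conf.mulFunctional_eq_prod X hb (by intro x hx; simp [hx]),
    X.setLIntegral_counting hA hb hf, ENNReal.toReal_ofReal (by positivity), Finset.mul_sum,
    Real.exp_sum]
  have h1 : ∏ x ∈ (X.finite_inter A hb).toFinset,
      (1 - s * (A.indicator (fun x => (f x : ℝ)) x : ℂ)) ^ X.mult x =
      ((∏ x ∈ (X.finite_inter A hb).toFinset, (1 - s * (f x : ℝ)) ^ X.mult x : ℝ) : ℂ) := by
    push_cast
    refine Finset.prod_congr rfl fun x hx => ?_
    have hx : x ∈ A := by simpa using (by simpa using hx : _ ∧ _).2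
    simp [hx]
  rw [h1, Complex.ofReal_re]
  refine sub_le_sub_left (Finset.prod_le_prod (fun x hx => ?_) fun x hx => ?_) 1
  · have hx : x ∈ A := by simpa using (by simpa using hx : _ ∧ _).2
    exact pow_nonneg (sub_nonneg.2 (hC x hx)) _
  · have hx : x ∈ A := by simpa using (by simpa using hx : _ ∧ _).2
    calc (1 - s * (f x : ℝ)) ^ X.mult x ≤ Real.exp (-(s * f x)) ^ X.mult x :=
          pow_le_pow_left₀ (sub_nonneg.2 (hC x hx)) (Real.one_sub_le_exp_neg _) _
      _ = _ := by rw [← Real.exp_nat_mul]; ring_nf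

theorem tendsto_one_sub_exp_div (y : ℝ) {s : ℕ → ℝ} (hs : ∀ n, 0 < s n)
    (hlim : Tendsto s atTop (𝓝 0)) :
    Tendsto (fun n => (1 - Real.exp (-s n * y)) / s n) atTop (𝓝 y) := by
  have h1 : HasDerivAt (fun t : ℝ => 1 - Real.exp (-t * y)) y 0 := by
    have h2 : HasDerivAt (fun t : ℝ => -t * y) (-1 * y) 0 := (hasDerivAt_neg 0).mul_const y
    have h3 := h2.exp.const_sub 1
    simpa using h3
  have h2 := h1.tendsto_slope_zero
  have h3 : Tendsto s atTop (𝓝[≠] 0) :=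
    tendsto_nhdsWithin_iff.2 ⟨hlim, Eventually.of_forall fun n => (hs n).ne'⟩
  refine (h2.comp h3).congr fun n => ?_
  simp [div_eq_inv_mul]

variable {f : E → ℝ≥0} {K T : L2 μ →L[ℂ] L2 μ} {P : ProbabilityMeasure (Conf E)}

/-- The first moment bound `𝔼 ∑_{x ∈ X ∩ A} f(x) ≤ tr (χ_A √f K √f χ_A)`, for bounded `A`. -/
theorem IsDeterminantal.lintegral_le_of_isBounded {A₀ : ℕ → Set E} (hA₀ : IsExhaustion f A₀)
    (hP : IsDeterminantal K P) (hf : Measurable f) (hK : K.IsPositive)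
    (hT : IsWeighted (fun x => NNReal.sqrt (f x)) K T) (hTpos : T.IsPositive)
    {A : Set E} (hA : MeasurableSet A) (hb : Bornology.IsBounded A)
    (hKA : IsTraceClass (chiOp μ A ∘L K ∘L chiOp μ A)) {C : ℝ≥0} (hC : ∀ x ∈ A, f x ≤ C) :
    ∫⁻ X, ∫⁻ x in A, f x ∂X.counting ∂(P : Measure (Conf E)) ≤ hsSq (sqrtAbs T ∘L chiOp μ A) := by
  set w : E → ℝ≥0 := fun x => NNReal.sqrt (f x) with hw_def
  have hw : Measurable w := NNReal.continuous_sqrt.measurable.comp hf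
  have hwC : ∀ x ∈ A, (w x : ℝ) ≤ NNReal.sqrt C := fun x hx => by
    exact_mod_cast NNReal.sqrt_le_sqrt.2 (hC x hx)
  set M := chiOp μ A ∘L K ∘L chiOp μ A with hMdef
  have hM : M.IsPositive := by
    have := hK.conj_adjoint (chiOp μ A)
    rwa [chiOp_adjoint hA] at this
  set G := weightOp μ w A ∘L weightOp μ w A
  set tr : ℝ := (hsSq (sqrtAbs T ∘L chiOp μ A)).toReal
  set c : ℝ := ∑' F, ‖principalMinor (G ∘L M) F‖
  have hexp {s : ℝ} (hs0 : 0 ≤ s) (hs1 : s ≤ 1) :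
      1 - (fredholmDet ((-s : ℂ) • (G ∘L M))).re ≤ s * tr + s ^ 2 * c := by
    have h1 := norm_fredholmDet_sub_le hM hKA G hs0 hs1
    rw [hT.tsum_inner hw hK hTpos hA hKA hwC] at h1
    have h2 := (abs_le.1 ((Complex.abs_re_le_norm _).trans h1)).1
    have h3 : (1 - (s : ℂ) * ((hsSq (sqrtAbs T ∘L chiOp μ A)).toReal : ℂ)).re = 1 - s * tr := by
      rw [← Complex.ofReal_mul]; simp [tr]
    rw [Complex.sub_re, h3] at h2
    linarith
  -- Since `f = w²`, multiplication by `-s f χ_A` is `-s G`, and the determinant in the definition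
  -- of `P` is that of `1 - s G M`.
  have hG (s : ℝ) (hs : 0 ≤ s) : mulOp μ (fun x => (1 - s * (A.indicator (fun x => (f x : ℝ)) x : ℂ)) - 1)
      ∘L K ∘L chiOp μ A = (-s : ℂ) • (G ∘L M) := by
    have hm := memLp_weight (μ := μ) hw hA hwC
    have hm2 : MemLp (fun x => (1 - s * (A.indicator (fun x => (f x : ℝ)) x : ℂ)) - 1) ∞ μ := by
      refine memLp_top_of_measurable ?_ (s * C) fun x => ?_
      · have := (hf.coe_nnreal_real.indicator hA)
        fun_prop
      · by_cases hx : x ∈ A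
        · have : (f x : ℝ) ≤ C := by exact_mod_cast hC x hx
          simp [hx, abs_of_nonneg hs]
          gcongr
        · simp [hx]
          positivity
    ext1 φ
    apply Lp.ext
    filter_upwards [mulOp_apply hm2 (K (chiOp μ A φ)), Lp.coeFn_smul (-s : ℂ) (G (M φ)),
      mulOp_apply hm (weightOp μ w A (M φ)), mulOp_apply hm (M φ),
      chiOp_apply hA (K (chiOp μ A φ))] with x h1 h2 h3 h4 h5
    have h6 : (G (M φ)) x = _ := h3
    have h7 : (weightOp μ w A (M φ)) x = _ := h4
    have h8 : (M φ) x = _ := h5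
    simp only [ContinuousLinearMap.comp_apply, smul_apply] at h1 h2 ⊢
    rw [h1, h2, Pi.smul_apply, h6, h7, h8]
    by_cases hx : x ∈ A
    · have : ((f x : ℝ) : ℂ) = (w x : ℝ) * (w x : ℝ) := by
        rw [← Complex.ofReal_mul, ← NNReal.coe_mul, NNReal.mul_self_sqrt]
      simp only [hx, indicator_of_mem, this, smul_eq_mul]
      ring
    · simp [hx]
  -- Any positive null sequence with `s ≤ 1` and `s C ≤ 1` would do; the added 1 covers `C = 0`.
  let s : ℕ → ℝ := fun n => 1 / ((C + 1 + n : ℝ≥0) : ℝ)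
  have hs0 (n) : 0 < s n := by simp only [s]; positivity
  have hs1 (n) : s n ≤ 1 := by
    simp only [s]
    rw [div_le_one (by positivity)]
    push_cast
    linarith [C.coe_nonneg, (Nat.cast_nonneg n : (0 : ℝ) ≤ n)]
  have hsC (n) (x) (hx : x ∈ A) : s n * f x ≤ 1 := by
    simp only [s]
    rw [div_mul_eq_mul_div, one_mul, div_le_one (by positivity)]
    have : (f x : ℝ) ≤ C := by exact_mod_cast hC x hx
    push_cast
    linarith [(Nat.cast_nonneg n : (0 : ℝ) ≤ n)]
  have hslim : Tendsto s atTop (𝓝 0) := by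
    refine squeeze_zero (fun n => (hs0 n).le) (fun n => ?_) tendsto_one_div_add_atTop_nhds_zero_nat
    simp only [s]
    gcongr
    push_cast
    linarith [C.coe_nonneg]
  set Y : Conf E → ℝ := fun X => (∫⁻ x in A, f x ∂X.counting).toReal
  have hYm : Measurable Y :=
    (Conf.measurable_setLIntegral_counting hA₀ hf.coe_nnreal_ennreal hA).ennreal_toReal
  have hbound (n : ℕ) : ∫⁻ X, ENNReal.ofReal ((1 - Real.exp (-s n * Y X)) / s n)
      ∂(P : Measure (Conf E)) ≤ ENNReal.ofReal (tr + s n * c) := by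
    obtain ⟨hint, heq⟩ := hP (fun x => 1 - s n * (A.indicator (fun x => (f x : ℝ)) x : ℂ)) A
      (by have := (hf.coe_nnreal_real.indicator hA); fun_prop)
      ⟨1 + s n * C, fun x => by
        refine (norm_sub_le _ _).trans ?_
        rw [norm_one, norm_mul, Complex.norm_real, Real.norm_of_nonneg (hs0 n).le]
        by_cases hx : x ∈ A
        · have h1 : (f x : ℝ) ≤ C := by exact_mod_cast hC x hx
          have := (hs0 n).le
          simp [hx]
          gcongr
        · have := (hs0 n).le
          simp [hx]
          positivity⟩ hb hA (fun x hx => by simp [hx])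
    rw [hG (s n) (hs0 n).le] at heq
    have hre : ∫ X, (Conf.mulFunctional
        (fun x => 1 - s n * (A.indicator (fun x => (f x : ℝ)) x : ℂ)) X).re
        ∂(P : Measure (Conf E)) = (fredholmDet ((-s n : ℂ) • (G ∘L M))).re := by
      rw [← heq]
      exact integral_re hint
    calc _ ≤ ∫⁻ X, ENNReal.ofReal ((1 - (Conf.mulFunctional
          (fun x => 1 - s n * (A.indicator (fun x => (f x : ℝ)) x : ℂ)) X).re) / s n)
          ∂(P : Measure (Conf E)) := by
          refine lintegral_mono fun X => ENNReal.ofReal_le_ofReal ?_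
          exact div_le_div_of_nonneg_right (one_sub_exp_le_one_sub_re_mulFunctional hf hA hb (hsC n) X) (hs0 n).le
      _ = ENNReal.ofReal (∫ X, (1 - (Conf.mulFunctional
          (fun x => 1 - s n * (A.indicator (fun x => (f x : ℝ)) x : ℂ)) X).re) / s n
          ∂(P : Measure (Conf E))) := by
          rw [ofReal_integral_eq_lintegral_ofReal]
          · exact ((integrable_const 1).sub hint.re).div_const _
          · refine Eventually.of_forall fun X => div_nonneg ?_ (hs0 n).le
            refine le_trans ?_ (one_sub_exp_le_one_sub_re_mulFunctional hf hA hb (hsC n) X)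
            rw [sub_nonneg, Real.exp_le_one_iff, neg_mul, Left.neg_nonpos_iff]
            exact mul_nonneg (hs0 n).le ENNReal.toReal_nonneg
      _ ≤ _ := by
          refine ENNReal.ofReal_le_ofReal ?_
          have hint' : Integrable (fun X => (Conf.mulFunctional
            (fun x => 1 - s n * (A.indicator (fun x => (f x : ℝ)) x : ℂ)) X).re)
            (P : Measure (Conf E)) := hint.re
          rw [integral_div, integral_sub (integrable_const 1) hint', hre]
          simp only [integral_const, probReal_univ, smul_eq_mul, mul_one]
          rw [div_le_iff₀ (hs0 n)]
          refine (hexp (hs0 n).le (hs1 n)).trans_eq ?_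
          ring
  -- The sum over the bounded set `A` is finite, hence the limit of its difference quotients, and
  -- Fatou's lemma transfers `hbound` to it.
  have hpt (X : Conf E) : ∫⁻ x in A, f x ∂X.counting =
      liminf (fun n => ENNReal.ofReal ((1 - Real.exp (-s n * Y X)) / s n)) atTop := by
    rw [(ENNReal.tendsto_ofReal (tendsto_one_sub_exp_div (Y X) hs0 hslim)).liminf_eq,
      ENNReal.ofReal_toReal]
    rw [X.setLIntegral_counting hA hb hf]
    exact ENNReal.ofReal_ne_top
  simp only [hpt]
  refine (lintegral_liminf_le fun n => by fun_prop).trans ?_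
  have hlim : Tendsto (fun n => ENNReal.ofReal (tr + s n * c)) atTop (𝓝 (ENNReal.ofReal tr)) := by
    refine ENNReal.tendsto_ofReal ?_
    simpa using (hslim.mul_const c).const_add tr
  calc _ ≤ liminf (fun n => ENNReal.ofReal (tr + s n * c)) atTop :=
        liminf_le_liminf (Eventually.of_forall hbound)
    _ = ENNReal.ofReal tr := hlim.liminf_eq
    _ ≤ _ := ENNReal.ofReal_toReal_le

/-- The first moment bound `𝔼 ∑_{x ∈ X ∩ B} f(x) ≤ tr (χ_B √f K √f χ_B)`. -/
theorem IsDeterminantal.lintegral_le {A : ℕ → Set E} (hA : IsExhaustion f A)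
    (hP : IsDeterminantal K P) (hf : Measurable f) (hK : K.IsPositive) (hKloc : IsLocTraceClass K)
    (hT : IsWeighted (fun x => NNReal.sqrt (f x)) K T) (hTpos : T.IsPositive)
    {B : Set E} (hB : MeasurableSet B) :
    ∫⁻ X, ∫⁻ x in B, f x ∂X.counting ∂(P : Measure (Conf E)) ≤ hsSq (sqrtAbs T ∘L chiOp μ B) := by
  have hm (n) : MeasurableSet (B ∩ A n) := hB.inter (hA.measurableSet n)
  have hbd (n) : Bornology.IsBounded (B ∩ A n) := (hA.isBounded n).subset inter_subset_right
  have hmono : Monotone fun n => B ∩ A n := fun m n hmn =>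
    inter_subset_inter_right _ (hA.monotone hmn)
  have h1 (X : Conf E) : ∫⁻ x in B, f x ∂X.counting =
      ⨆ n, ∫⁻ x in B ∩ A n, f x ∂X.counting := by
    conv_lhs => rw [← inter_univ B, ← hA.iUnion_eq, inter_iUnion]
    rw [setLIntegral_iUnion_of_directed _ hmono.directed_le]
  simp only [h1]
  rw [lintegral_iSup (fun n => Conf.measurable_setLIntegral_counting hA hf.coe_nnreal_ennreal (hm n))
    (fun m n hmn X => lintegral_mono_set (hmono hmn))]
  refine iSup_le fun n => ?_
  refine (hP.lintegral_le_of_isBounded hA hf hK hT hTpos (hm n) (hbd n) (hKloc _ (hbd n) (hm n))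
    (fun x hx => hA.le n x hx.2)).trans ?_
  rw [← chiOp_comp hB (hA.measurableSet n), ← ContinuousLinearMap.comp_assoc]
  refine (hsSq_comp_le_right _ _).trans (mul_le_of_le_one_right' (pow_le_one' ?_ 2))
  rw [← ofReal_norm]
  exact ENNReal.ofReal_le_one.2 (norm_chiOp_le (hA.measurableSet n))

theorem IsWeighted.isPositive_of_isExhaustion {A : ℕ → Set E} (hA : IsExhaustion f A)
    (hT : IsWeighted (fun x => NNReal.sqrt (f x)) K T) (hf : Measurable f) (hK : K.IsPositive) :
    T.IsPositive :=
  hT.isPositive (NNReal.continuous_sqrt.measurable.comp hf) hK hA.measurableSet hA.monotone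
    hA.iUnion_eq (fun n => NNReal.sqrt n) fun n x hx => by
      exact_mod_cast NNReal.sqrt_le_sqrt.2 (hA.le n x hx)

/-- The sum of `f` over the whole configuration has expectation bounded by a multiple of the trace
norm of `T`, so it is almost surely finite. -/
theorem IsDeterminantal.ae_mem_confF {A : ℕ → Set E} (hA : IsExhaustion f A)
    (hP : IsDeterminantal K P) (hf : Measurable f) (hK : K.IsPositive) (hKloc : IsLocTraceClass K)
    (hT : IsWeighted (fun x => NNReal.sqrt (f x)) K T) (hTtr : IsTraceClass T) :
    ∀ᵐ X ∂(P : Measure (Conf E)), X ∈ confF f := by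
  have h1 := hP.lintegral_le hA hf hK hKloc hT (hT.isPositive_of_isExhaustion hA hf hK) .univ
  simp only [Measure.restrict_univ] at h1
  have h2 : hsSq (sqrtAbs T ∘L chiOp μ univ) ≠ ∞ :=
    ne_top_of_le_ne_top (ENNReal.mul_ne_top hTtr.hsSq_ne_top (by simp)) (hsSq_comp_le_right _ _)
  filter_upwards [ae_lt_top (Conf.measurable_lintegral_counting hA hf.coe_nnreal_ennreal)
    (ne_top_of_le_ne_top h2 h1)] with X hX
  exact (Conf.mem_confF_iff hf).2 hX

end FirstMoment

/-! ### Weak convergence of finite measures from open sets. -/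

section Portmanteau

theorem eventually_toReal_sub_lt {b : ℕ → ℝ≥0∞} {b₀ : ℝ≥0∞} (hb₀ : b₀ ≠ ∞) (hb : ∀ i, b i ≠ ∞)
    (h : b₀ ≤ liminf b atTop) {ε : ℝ} (hε : 0 < ε) : ∀ᶠ i in atTop, b₀.toReal - ε < (b i).toReal := by
  rcases lt_or_ge (b₀.toReal - ε) 0 with h1 | h1
  · exact Eventually.of_forall fun i => h1.trans_le ENNReal.toReal_nonneg
  · have h2 : ENNReal.ofReal (b₀.toReal - ε) < liminf b atTop := by
      refine lt_of_lt_of_le ?_ h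
      rw [ENNReal.ofReal_lt_iff_lt_toReal h1 hb₀]
      linarith
    filter_upwards [eventually_lt_of_lt_liminf h2] with i hi
    exact (ENNReal.ofReal_lt_iff_lt_toReal h1 (hb i)).1 hi

/-- The portmanteau theorem for finite measures: a lower bound on open sets and convergence of the
total masses imply weak convergence. -/
theorem FiniteMeasure.tendsto_of_forall_isOpen_le_liminf {E : Type*} [MeasurableSpace E]
    [TopologicalSpace E] [OpensMeasurableSpace E] {ν : ℕ → FiniteMeasure E} {ν₀ : FiniteMeasure E}
    (hmass : Tendsto (fun i => (ν i).mass) atTop (𝓝 ν₀.mass))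
    (h : ∀ G, IsOpen G → (ν₀ : Measure E) G ≤ liminf (fun i => (ν i : Measure E) G) atTop) :
    Tendsto ν atTop (𝓝 ν₀) := by
  rw [FiniteMeasure.tendsto_iff_forall_testAgainstNN_tendsto]
  intro f
  set c : ℝ≥0 := nndist f 0
  have hfc (x) : f x ≤ c := BoundedContinuousFunction.NNReal.upper_bound f x
  let a (m : FiniteMeasure E) : ℝ≥0∞ := ∫⁻ x, f x ∂(m : Measure E)
  -- The integrals of `f` and of `c - f` are both lower semicontinuous along the sequence, while
  -- their sum `c · mass` converges. Hence each converges.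
  let b (m : FiniteMeasure E) : ℝ≥0∞ := ∫⁻ x, ENNReal.ofReal (c - f x) ∂(m : Measure E)
  have hab (m : FiniteMeasure E) : a m + b m = c * m.mass := by
    have h1 : Measurable fun x => (f x : ℝ≥0∞) := f.continuous.measurable.coe_nnreal_ennreal
    rw [← lintegral_add_left h1]
    have h2 (x) : (f x : ℝ≥0∞) + ENNReal.ofReal (c - f x) = c := by
      rw [← ENNReal.ofReal_coe_nnreal, ← ENNReal.ofReal_add (by positivity)
        (sub_nonneg.2 (by exact_mod_cast hfc x))]
      simp
    simp [h2]
  have ha (m) : a m ≠ ∞ := fun h => by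
    have := hab m
    rw [h, top_add] at this
    exact ENNReal.mul_ne_top (by simp) (by simp) this.symm
  have hb (m) : b m ≠ ∞ := fun h => by
    have := hab m
    rw [h, add_top] at this
    exact ENNReal.mul_ne_top (by simp) (by simp) this.symm
  have habr (m : FiniteMeasure E) : (a m).toReal + (b m).toReal = c * m.mass := by
    rw [← ENNReal.toReal_add (ha m) (hb m), hab m, ENNReal.toReal_mul]
    rfl
  have hla : a ν₀ ≤ liminf (fun i => a (ν i)) atTop := by
    have := lintegral_le_liminf_lintegral_of_forall_isOpen_measure_le_liminf_measure
      (f := fun x => (f x : ℝ)) (by fun_prop) (fun x => (f x).coe_nonneg) h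
    simpa only [ENNReal.ofReal_coe_nnreal] using this
  have hlb : b ν₀ ≤ liminf (fun i => b (ν i)) atTop :=
    lintegral_le_liminf_lintegral_of_forall_isOpen_measure_le_liminf_measure
      (f := fun x => (c - f x : ℝ)) (by fun_prop)
      (fun x => sub_nonneg.2 (by exact_mod_cast hfc x)) h
  have hlim : Tendsto (fun i => (c : ℝ) * (ν i).mass) atTop (𝓝 (c * ν₀.mass)) :=
    (NNReal.tendsto_coe.2 hmass).const_mul _
  have key : Tendsto (fun i => (a (ν i)).toReal) atTop (𝓝 (a ν₀).toReal) := by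
    rw [Metric.tendsto_nhds] at hlim ⊢
    intro ε hε
    filter_upwards [eventually_toReal_sub_lt (ha ν₀) (fun i => ha (ν i)) hla hε,
      eventually_toReal_sub_lt (hb ν₀) (fun i => hb (ν i)) hlb (half_pos hε),
      hlim _ (half_pos hε)] with i h1 h2 h3
    rw [← habr, ← habr, Real.dist_eq, abs_lt] at h3
    rw [Real.dist_eq, abs_lt]
    constructor <;> linarith [h3.1, h3.2]
  rw [← NNReal.tendsto_coe]
  exact key

end Portmanteau

/-! ### Countably many coordinates on the space of finite measures. -/

section TestFunctions

open Metric

variable {E : Type*} [MetricSpace E]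

/-- A continuous function which increases to the indicator of the open set `W` as `k → ∞`. -/
def innerApprox (W : Set E) (k : ℕ) (x : E) : ℝ≥0∞ := min 1 (k * infEDist x Wᶜ)

theorem innerApprox_le_one (W : Set E) (k : ℕ) (x : E) : innerApprox W k x ≤ 1 := min_le_left _ _

theorem continuous_innerApprox (W : Set E) (k : ℕ) : Continuous (innerApprox W k) := by
  unfold innerApprox
  refine continuous_const.min ?_
  exact (ENNReal.continuous_const_mul (by simp)).comp continuous_infEDist

theorem innerApprox_mono {W W' : Set E} (hW : W ⊆ W') {k k' : ℕ} (hk : k ≤ k') (x : E) :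
    innerApprox W k x ≤ innerApprox W' k' x := by
  unfold innerApprox
  gcongr

theorem innerApprox_of_notMem {W : Set E} {x : E} (hx : x ∉ W) (k : ℕ) :
    innerApprox W k x = 0 := by
  simp [innerApprox, infEDist_zero_of_mem (show x ∈ Wᶜ from hx)]

theorem exists_innerApprox_eq_one {W : Set E} (hW : IsOpen W) {x : E} (hx : x ∈ W) :
    ∃ k, innerApprox W k x = 1 := by
  have h1 : infEDist x Wᶜ ≠ 0 := fun h =>
    (mem_iff_infEDist_zero_of_closed hW.isClosed_compl).2 h hx
  obtain ⟨k, hk⟩ := ENNReal.exists_nat_mul_gt h1 ENNReal.one_ne_top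
  exact ⟨k, min_eq_left hk.le⟩

/-- `innerApprox` as a bounded continuous function. -/
def innerApproxBCNN (W : Set E) (k : ℕ) : BoundedContinuousFunction E ℝ≥0 where
  toFun x := (innerApprox W k x).toNNReal
  continuous_toFun := by
    refine ENNReal.continuousOn_toNNReal.comp_continuous (continuous_innerApprox W k) fun x => ?_
    exact ((innerApprox_le_one W k x).trans_lt ENNReal.one_lt_top).ne
  map_bounded' := by
    refine ⟨1, fun x y => ?_⟩
    have h (z) : (innerApprox W k z).toNNReal ≤ 1 :=
      ENNReal.toNNReal_mono ENNReal.one_ne_top (innerApprox_le_one W k z)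
    have hx : ((innerApprox W k x).toNNReal : ℝ) ≤ 1 := by exact_mod_cast h x
    have hy : ((innerApprox W k y).toNNReal : ℝ) ≤ 1 := by exact_mod_cast h y
    rw [NNReal.dist_eq, abs_le]
    constructor <;> linarith [(innerApprox W k x).toNNReal.coe_nonneg,
      (innerApprox W k y).toNNReal.coe_nonneg]

theorem coe_innerApproxBCNN (W : Set E) (k : ℕ) (x : E) :
    (innerApproxBCNN W k x : ℝ≥0∞) = innerApprox W k x :=
  ENNReal.coe_toNNReal ((innerApprox_le_one W k x).trans_lt ENNReal.one_lt_top).ne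

variable [SecondCountableTopology E]

variable (E) in
/-- The index set of a countable family of test functions. -/
abbrev TestIndex : Type _ := Option (Finset (TopologicalSpace.countableBasis E) × ℕ)

/-- A countable family of test functions that determines weak convergence of finite measures. -/
def testFn : TestIndex E → BoundedContinuousFunction E ℝ≥0
  | none => 1
  | some p => innerApproxBCNN (⋃ W ∈ p.1, (W : Set E)) p.2

theorem testFn_le_one (i : TestIndex E) (x : E) : testFn i x ≤ 1 := by
  cases i with
  | none => exact le_rfl
  | some p => exact ENNReal.toNNReal_mono ENNReal.one_ne_top (innerApprox_le_one _ _ _)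

theorem nnnorm_sum_testFn_le (J : Finset (TestIndex E)) (t : J → ℝ) (x : E) :
    ‖∑ j, t j * testFn j.1 x‖₊ ≤ ∑ j, ‖t j‖₊ := by
  refine (nnnorm_sum_le _ _).trans (Finset.sum_le_sum fun j _ => ?_)
  rw [nnnorm_mul]
  exact mul_le_of_le_one_right' (by simpa using testFn_le_one j.1 x)

variable [MeasurableSpace E] [OpensMeasurableSpace E]

/-- An open set is the union of the basic sets inside it, and monotone convergence applies along a
directed countable family. Finite unions of basic sets are used to make the family directed. -/
theorem measure_eq_iSup_lintegral_innerApprox (m : Measure E) {G : Set E} (hG : IsOpen G) :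
    m G = ⨆ p : {p : Finset (TopologicalSpace.countableBasis E) × ℕ //
      ⋃ W ∈ p.1, (W : Set E) ⊆ G}, ∫⁻ x, innerApprox (⋃ W ∈ p.1.1, (W : Set E)) p.1.2 x ∂m := by
  classical
  rw [← lintegral_iSup_directed fun p => (continuous_innerApprox _ _).measurable.aemeasurable]
  · rw [← lintegral_indicator_one hG.measurableSet]
    congr 1
    ext x
    by_cases hx : x ∈ G
    · rw [indicator_of_mem hx]
      refine le_antisymm ?_ (iSup_le fun p => innerApprox_le_one _ _ _)
      obtain ⟨W, hW, hxW, hWG⟩ :=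
        (TopologicalSpace.isBasis_countableBasis E).exists_subset_of_mem_open hx hG
      obtain ⟨k, hk⟩ := exists_innerApprox_eq_one (TopologicalSpace.isOpen_of_mem_countableBasis hW) hxW
      refine le_iSup_of_le ⟨({⟨W, hW⟩}, k), by simpa using hWG⟩ ?_
      simp [hk]
    · rw [indicator_of_notMem hx]
      symm
      rw [ENNReal.iSup_eq_zero]
      exact fun p => innerApprox_of_notMem (fun h => hx (p.2 h)) _
  · rintro ⟨⟨J, k⟩, hp⟩ ⟨⟨J', k'⟩, hp'⟩
    refine ⟨⟨(J ∪ J', max k k'), ?_⟩, fun x => innerApprox_mono ?_ (le_max_left _ _) x,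
      fun x => innerApprox_mono ?_ (le_max_right _ _) x⟩
    · simp only [iUnion_subset_iff, Finset.mem_union] at hp hp' ⊢
      rintro W (hW | hW)
      exacts [hp W hW, hp' W hW]
    · exact biUnion_subset_biUnion_left fun W hW => Finset.mem_union_left _ hW
    · exact biUnion_subset_biUnion_left fun W hW => Finset.mem_union_right _ hW

/-- The constant test function gives convergence of the masses. The others give the lower bound on
open sets, each being a supremum of test integrals. -/
theorem FiniteMeasure.tendsto_of_tendsto_testFn {ν : ℕ → FiniteMeasure E} {ν₀ : FiniteMeasure E}
    (h : ∀ i, Tendsto (fun n => (ν n).testAgainstNN (testFn i)) atTop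
      (𝓝 (ν₀.testAgainstNN (testFn i)))) : Tendsto ν atTop (𝓝 ν₀) := by
  refine FiniteMeasure.tendsto_of_forall_isOpen_le_liminf ?_ fun G hG => ?_
  · simpa [testFn] using h none
  · rw [measure_eq_iSup_lintegral_innerApprox _ hG]
    refine iSup_le fun p => ?_
    have h1 (m : FiniteMeasure E) : (m.testAgainstNN (testFn (some p.1)) : ℝ≥0∞) =
        ∫⁻ x, innerApprox (⋃ W ∈ p.1.1, (W : Set E)) p.1.2 x ∂(m : Measure E) := by
      rw [FiniteMeasure.testAgainstNN_coe_eq]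
      exact lintegral_congr fun x => coe_innerApproxBCNN _ _ _
    have h2 := ENNReal.tendsto_coe.2 (h (some p.1))
    simp only [h1] at h2
    rw [← h2.liminf_eq]
    refine liminf_le_liminf (Eventually.of_forall fun n => ?_)
    rw [measure_eq_iSup_lintegral_innerApprox _ hG]
    exact le_iSup (fun p : {p : Finset (TopologicalSpace.countableBasis E) × ℕ //
      ⋃ W ∈ p.1, (W : Set E) ⊆ G} => ∫⁻ x, innerApprox (⋃ W ∈ p.1.1, (W : Set E)) p.1.2 x
        ∂(ν n : Measure E)) p

/-- The integrals of the test functions, as coordinates on the space of finite measures. -/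
def testCoord (ν : MFin E) (i : TestIndex E) : ℝ := FiniteMeasure.testAgainstNN (Ω := E) ν (testFn i)

theorem isInducing_testCoord : IsInducing (testCoord : MFin E → TestIndex E → ℝ) := by
  rw [isInducing_iff_nhds]
  intro ν
  have hcont : Continuous (testCoord : MFin E → TestIndex E → ℝ) :=
    continuous_pi fun i => NNReal.continuous_coe.comp
      (FiniteMeasure.continuous_testAgainstNN_eval (testFn i))
  refine le_antisymm (hcont.tendsto ν).le_comap ?_
  have : Tendsto (id : MFin E → MFin E) (comap testCoord (𝓝 (testCoord ν))) (𝓝 ν) := by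
    -- Sequences suffice: the index set is countable, so the pulled-back neighbourhood filter is
    -- countably generated.
    refine tendsto_of_seq_tendsto fun u hu => ?_
    refine FiniteMeasure.tendsto_of_tendsto_testFn fun i => ?_
    have h1 := tendsto_pi_nhds.1 (tendsto_comap_iff.1 hu) i
    exact NNReal.tendsto_coe.1 h1
  exact this

/-- Open sets of `MFin E` are preimages of open sets of a countable power of ℝ, whose Borel and
product σ-algebras agree. -/
theorem measurable_of_measurable_testCoord {Ω : Type*} [MeasurableSpace Ω] {s : Ω → MFin E}
    (h : ∀ i, Measurable fun ω => testCoord (s ω) i) : Measurable s := by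
  have h1 : Measurable fun ω => testCoord (s ω) := measurable_pi_iff.2 h
  refine measurable_of_isOpen fun G hG => ?_
  obtain ⟨V, hV, rfl⟩ := isInducing_testCoord.isOpen_iff.1 hG
  exact h1 hV.measurableSet

end TestFunctions

/-! ### Lévy's theorem for countably many coordinates. -/

section CharFun

variable {M ι : Type*} [TopologicalSpace M] [MeasurableSpace M] [BorelSpace M]

/-- Every open set of a product is the directed union of open sets depending on finitely many
coordinates. -/
theorem exists_isOpen_cylinders {V : Set (ι → ℝ)} (hV : IsOpen V) :
    ∃ U : (J : Finset ι) → Set (J → ℝ), (∀ J, IsOpen (U J)) ∧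
      Monotone (fun J => J.restrict ⁻¹' U J : Finset ι → Set (ι → ℝ)) ∧
      ⋃ J, J.restrict ⁻¹' U J = V := by
  -- `U J` is the largest open set whose cylinder lies in `V`, which makes the cylinders increase
  -- with `J`.
  refine ⟨fun J => ⋃₀ {U | IsOpen U ∧ J.restrict ⁻¹' U ⊆ V}, fun J => isOpen_sUnion fun U hU => hU.1,
    ?_, ?_⟩
  · rintro J J' hJ x ⟨U, ⟨hU, hUV⟩, hx⟩
    exact ⟨Finset.restrict₂ (π := fun _ => ℝ) hJ ⁻¹' U,
      ⟨hU.preimage (continuous_pi fun j => continuous_apply _), hUV⟩, hx⟩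
  · refine Subset.antisymm (iUnion_subset fun J x hx => ?_) fun x hx => ?_
    · obtain ⟨U, ⟨-, hUV⟩, hxU⟩ := hx
      exact hUV hxU
    · obtain ⟨J, u, hu, huV⟩ := isOpen_pi_iff.1 hV x hx
      refine mem_iUnion.2 ⟨J, univ.pi fun j => u j, ⟨?_, ?_⟩, ?_⟩
      · exact isOpen_set_pi finite_univ fun j _ => (hu j j.2).1
      · intro y hy
        exact huV fun j hj => hy ⟨j, hj⟩ (mem_univ _)
      · exact fun j _ => (hu j j.2).2

/-- Weak convergence on a space with countably many real coordinates follows from convergence of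
the characteristic functions of the finite-dimensional distributions. -/
theorem ProbabilityMeasure.tendsto_of_isInducing [Countable ι] {Φ : M → ι → ℝ} (hΦ : IsInducing Φ)
    {Q : ℕ → ProbabilityMeasure M} {Q₀ : ProbabilityMeasure M}
    (h : ∀ (J : Finset ι) (t : J → ℝ), Tendsto
      (fun n => ∫ m, Complex.exp (Complex.I * (∑ j, t j * Φ m j : ℝ)) ∂(Q n : Measure M)) atTop
      (𝓝 (∫ m, Complex.exp (Complex.I * (∑ j, t j * Φ m j : ℝ)) ∂(Q₀ : Measure M)))) :
    Tendsto Q atTop (𝓝 Q₀) := by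
  classical
  refine tendsto_of_forall_isOpen_le_liminf_nat' fun G hG => ?_
  obtain ⟨V, hV, rfl⟩ := hΦ.isOpen_iff.1 hG
  obtain ⟨U, hU, hmono, rfl⟩ := exists_isOpen_cylinders hV
  have hproj (J : Finset ι) : Continuous fun m => WithLp.toLp 2 (J.restrict (Φ m)) :=
    (PiLp.continuous_toLp 2 _).comp
      (continuous_pi fun j => (continuous_apply _).comp hΦ.continuous)
  have hcyl (J : Finset ι) : (Q₀ : Measure M) (Φ ⁻¹' (J.restrict ⁻¹' U J)) ≤
      liminf (fun n => (Q n : Measure M) (Φ ⁻¹' (J.restrict ⁻¹' U J))) atTop := by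
    have hUo : IsOpen ((WithLp.ofLp : EuclideanSpace ℝ J → (J → ℝ)) ⁻¹' U J) :=
      (hU J).preimage (PiLp.continuous_ofLp 2 _)
    have hm := (hproj J).measurable
    have key : Tendsto (fun n => (Q n).map hm.aemeasurable) atTop
        (𝓝 (Q₀.map hm.aemeasurable)) := by
      refine ProbabilityMeasure.tendsto_of_tendsto_charFun fun t => ?_
      have hcf (R : ProbabilityMeasure M) : charFun (R.map hm.aemeasurable : Measure _) t =
          ∫ m, Complex.exp (Complex.I * (∑ j, t j * Φ m j : ℝ)) ∂(R : Measure M) := by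
        rw [charFun_apply, ProbabilityMeasure.toMeasure_map,
          integral_map hm.aemeasurable (by fun_prop)]
        refine integral_congr_ae (Eventually.of_forall fun m => ?_)
        simp only [PiLp.inner_apply]
        rw [mul_comm]
        simp [mul_comm]
      simp only [hcf]
      exact h J t
    have h2 := ProbabilityMeasure.le_liminf_measure_open_of_tendsto key hUo
    simpa only [ProbabilityMeasure.toMeasure_map, Measure.map_apply hm hUo.measurableSet] using! h2
  -- The measure of the directed union is the supremum over `J`, so the bounds on cylinders pass to
  -- every open set.
  rw [preimage_iUnion, Directed.measure_iUnion]
  · refine iSup_le fun J => (hcyl J).trans ?_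
    exact liminf_le_liminf (Eventually.of_forall fun n => measure_mono
      (subset_iUnion (fun J => Φ ⁻¹' (J.restrict ⁻¹' U J)) J))
  · exact Monotone.directed_le fun J J' hJ => preimage_mono (hmono hJ)

end CharFun

/-! ### Linear statistics of a configuration. -/

section Configurations

variable {E : Type*} [MeasurableSpace E] [Bornology E]

theorem sigmaMeasure_eq_withDensity {f : E → ℝ≥0} (hf : Measurable f) (X : Conf E) :
    sigmaMeasure f X = X.counting.withDensity fun x => f x := by
  ext B hB
  rw [withDensity_apply _ hB, ← lintegral_indicator hB,
    X.lintegral_counting (hf.coe_nnreal_ennreal.indicator hB), sigmaMeasure,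
    Measure.sum_apply _ hB]
  refine tsum_congr fun x => ?_
  by_cases hx : x ∈ B <;> simp [hx, hB]

theorem Conf.restrict_counting (X : Conf E) {B : Set E} (hB : MeasurableSet B)
    (hb : Bornology.IsBounded B) : X.counting.restrict B =
      ∑ x ∈ (X.finite_inter B hb).toFinset, (X.mult x : ℝ≥0∞) • Measure.dirac x := by
  ext C hC
  rw [Measure.restrict_apply hC, X.counting_apply (hC.inter hB) (hb.subset inter_subset_right),
    Conf.count, finsum_mem_eq_sum_of_inter_support_eq (t := {x ∈ (X.finite_inter B hb).toFinset |
      C.indicator (1 : E → ℕ) x = 1}), Measure.coe_finsetSum, Finset.sum_apply, Finset.sum_filter]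
  · push_cast
    refine Finset.sum_congr rfl fun x _ => ?_
    by_cases hx : x ∈ C <;> simp [hx, hC]
  · ext x
    by_cases hx : x ∈ C <;> simp [hx]
    tauto

/-- This is the link between characteristic functions of linear statistics and Fredholm
determinants. -/
theorem Conf.mulFunctional_exp (X : Conf E) {B : Set E} (hB : MeasurableSet B)
    (hb : Bornology.IsBounded B) {h : E → ℝ} (hh : Measurable h) :
    Conf.mulFunctional (fun x => Complex.exp (Complex.I * (B.indicator h x : ℝ))) X =
      Complex.exp (Complex.I * (∫ x in B, h x ∂X.counting : ℝ)) := by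
  have hint (x : E) : Integrable h ((X.mult x : ℝ≥0∞) • Measure.dirac x) :=
    (integrable_dirac' hh.stronglyMeasurable enorm_lt_top).smul_measure (by simp)
  rw [X.restrict_counting hB hb, integral_finsetSum_measure fun x _ => hint x,
    X.mulFunctional_eq_prod hb (by intro x hx; simp [hx]), Complex.ofReal_sum, Finset.mul_sum,
    Complex.exp_sum]
  refine Finset.prod_congr rfl fun x hx => ?_
  have hx : x ∈ B := by simpa using (by simpa using hx : _ ∧ _).2
  rw [indicator_of_mem hx, integral_smul_measure, integral_dirac' _ _ hh.stronglyMeasurable,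
    ← Complex.exp_nat_mul]
  congr 1
  simp
  ring

theorem measurableSet_confF {f : E → ℝ≥0} {A : ℕ → Set E} (hA : IsExhaustion f A)
    (hf : Measurable f) : MeasurableSet (confF f) := by
  have : confF f = {X : Conf E | ∫⁻ x, f x ∂X.counting < ∞} := by
    ext X
    exact Conf.mem_confF_iff hf
  rw [this]
  exact measurableSet_lt (Conf.measurable_lintegral_counting hA hf.coe_nnreal_ennreal)
    measurable_const

theorem norm_exp_I_mul_sub_le (a b : ℝ) :
    ‖Complex.exp (Complex.I * a) - Complex.exp (Complex.I * b)‖ₑ ≤ ‖a - b‖ₑ := by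
  have h : Complex.exp (Complex.I * a) - Complex.exp (Complex.I * b) =
      Complex.exp (Complex.I * b) * (Complex.exp (Complex.I * ((a - b : ℝ) : ℂ)) - 1) := by
    rw [mul_sub, ← Complex.exp_add]
    push_cast
    ring_nf
  rw [← ofReal_norm, ← ofReal_norm, h, norm_mul, mul_comm Complex.I (b : ℂ),
    Complex.norm_exp_ofReal_mul_I, one_mul]
  exact ENNReal.ofReal_le_ofReal Real.norm_exp_I_mul_ofReal_sub_one_le

theorem integrable_mul_counting {f : E → ℝ≥0} (hf : Measurable f) {φ : E → ℝ} (hφ : Measurable φ)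
    {c : ℝ≥0} (hc : ∀ x, ‖φ x‖₊ ≤ c) {X : Conf E} (hX : X ∈ confF f) :
    Integrable (fun x => (f x : ℝ) * φ x) X.counting := by
  have h1 : Integrable (fun x => (f x : ℝ)) X.counting := by
    refine ⟨hf.coe_nnreal_real.aestronglyMeasurable, ?_⟩
    simpa [HasFiniteIntegral] using (Conf.mem_confF_iff hf).1 hX
  exact h1.mul_bdd (c := c) hφ.aestronglyMeasurable (Eventually.of_forall fun x => by exact_mod_cast hc x)

/-- The error of replacing a linear statistic by its restriction to `A`. -/
theorem enorm_integral_sub_setIntegral_le {f : E → ℝ≥0} (hf : Measurable f) {φ : E → ℝ}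
    (hφ : Measurable φ) {c : ℝ≥0} (hc : ∀ x, ‖φ x‖₊ ≤ c) {A : Set E} (hA : MeasurableSet A)
    {X : Conf E} (hX : X ∈ confF f) :
    ‖(∫ x, (f x : ℝ) * φ x ∂X.counting) - ∫ x in A, (f x : ℝ) * φ x ∂X.counting‖ₑ ≤
      c * ∫⁻ x in Aᶜ, f x ∂X.counting := by
  have hint := integrable_mul_counting hf hφ hc hX
  rw [← integral_add_compl hA hint, add_sub_cancel_left]
  refine (enorm_integral_le_lintegral_enorm _).trans ?_
  rw [← lintegral_const_mul _ hf.coe_nnreal_ennreal]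
  refine lintegral_mono fun x => ?_
  rw [enorm_mul, mul_comm]
  refine mul_le_mul' ?_ ?_
  · rw [enorm_eq_nnnorm]
    exact ENNReal.coe_le_coe.2 (hc x)
  · simp [enorm_eq_nnnorm]

end Configurations

/-! ### Convergence of characteristic functionals. -/

section CharacteristicFunctional

variable {E : Type*} [MeasurableSpace E] [Bornology E] {μ : Measure E} {f : E → ℝ≥0}

/-- Convergence of bounded multiplicative functionals with bounded support. -/
theorem IsDeterminantal.tendsto_integral_mulFunctional {Kn : ℕ → L2 μ →L[ℂ] L2 μ}
    {K : L2 μ →L[ℂ] L2 μ} (hKn : ∀ n, (Kn n).IsPositive) (hK : K.IsPositive)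
    (hKloc : IsLocTraceClass K) (hlim : TendstoLocTraceClass Kn K)
    {Pn : ℕ → ProbabilityMeasure (Conf E)} {P : ProbabilityMeasure (Conf E)}
    (hPn : ∀ n, IsDeterminantal (Kn n) (Pn n)) (hP : IsDeterminantal K P)
    {g : E → ℂ} (hg : Measurable g) {C : ℝ} (hC : ∀ x, ‖g x‖ ≤ C)
    {B : Set E} (hB : MeasurableSet B) (hb : Bornology.IsBounded B) (hgB : ∀ x ∉ B, g x = 1) :
    Tendsto (fun n => ∫ X, Conf.mulFunctional g X ∂(Pn n : Measure (Conf E))) atTop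
      (𝓝 (∫ X, Conf.mulFunctional g X ∂(P : Measure (Conf E)))) := by
  have hm : MemLp (fun x => g x - 1) ∞ μ := by
    refine memLp_top_of_measurable (hg.sub measurable_const) (C + 1) fun x => ?_
    refine (norm_sub_le _ _).trans ?_
    rw [norm_one]
    exact add_le_add (hC x) le_rfl
  -- As `g - 1` vanishes off `B`, a second `χ_B` may be inserted; the operator next to the
  -- multiplication is then positive and converges in trace norm.
  have hcomp (A : L2 μ →L[ℂ] L2 μ) : mulOp μ (fun x => g x - 1) ∘L A ∘L chiOp μ B =
      mulOp μ (fun x => g x - 1) ∘L (chiOp μ B ∘L A ∘L chiOp μ B) := by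
    ext1 φ
    apply Lp.ext
    simp only [ContinuousLinearMap.comp_apply]
    filter_upwards [mulOp_apply hm (A (chiOp μ B φ)),
      mulOp_apply hm (chiOp μ B (A (chiOp μ B φ))), chiOp_apply hB (A (chiOp μ B φ))]
      with x h1 h2 h3
    rw [h1, h2, h3]
    by_cases hx : x ∈ B
    · simp [hx]
    · simp [hx, hgB x hx]
  have hpos {A : L2 μ →L[ℂ] L2 μ} (hA : A.IsPositive) :
      (chiOp μ B ∘L A ∘L chiOp μ B).IsPositive := by
    have := hA.conj_adjoint (chiOp μ B)
    rwa [chiOp_adjoint hB] at this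
  simp only [(hPn _ g B hg ⟨C, hC⟩ hb hB hgB).2, (hP g B hg ⟨C, hC⟩ hb hB hgB).2, hcomp]
  refine tendsto_fredholmDet (fun n => hpos (hKn n)) (hpos hK) (hKloc B hb hB) _ ?_
  refine (hlim B hb hB).congr fun n => ?_
  congr 1
  ext1 φ
  simp

/-- Truncation error of the characteristic functional of a linear statistic `L`. -/
theorem IsDeterminantal.enorm_integral_exp_sub_le {A : ℕ → Set E} (hA : IsExhaustion f A)
    {K T : L2 μ →L[ℂ] L2 μ} {P : ProbabilityMeasure (Conf E)}
    (hP : IsDeterminantal K P) (hf : Measurable f) (hK : K.IsPositive) (hKloc : IsLocTraceClass K)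
    (hT : IsWeighted (fun x => NNReal.sqrt (f x)) K T) (hTtr : IsTraceClass T)
    {φ : E → ℝ} (hφ : Measurable φ) {c : ℝ≥0} (hc : ∀ x, ‖φ x‖₊ ≤ c)
    {L : Conf E → ℝ} (hL : Measurable L)
    (hLφ : ∀ X ∈ confF f, L X = ∫ x, (f x : ℝ) * φ x ∂X.counting) (m : ℕ) :
    ‖(∫ X, Complex.exp (Complex.I * L X) ∂(P : Measure (Conf E))) -
      ∫ X, Conf.mulFunctional (fun x => Complex.exp (Complex.I *
        ((A m).indicator (fun x => (f x : ℝ) * φ x) x : ℝ))) X ∂(P : Measure (Conf E))‖ₑ ≤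
      c * hsSq (sqrtAbs T ∘L chiOp μ (A m)ᶜ) := by
  have hfφ : Measurable fun x => (f x : ℝ) * φ x := hf.coe_nnreal_real.mul hφ
  have hAm := hA.measurableSet m
  have hTpos := hT.isPositive_of_isExhaustion hA hf hK
  have hint1 : Integrable (fun X => Complex.exp (Complex.I * L X)) (P : Measure (Conf E)) := by
    refine Integrable.of_bound (C := 1) (by fun_prop) (Eventually.of_forall fun X => ?_)
    rw [mul_comm, Complex.norm_exp_ofReal_mul_I]
  have hint2 := (hP (fun x => Complex.exp (Complex.I *
    ((A m).indicator (fun x => (f x : ℝ) * φ x) x : ℝ))) (A m)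
    (by have := hfφ.indicator hAm; fun_prop)
    ⟨1, fun x => by rw [mul_comm, Complex.norm_exp_ofReal_mul_I]⟩ (hA.isBounded m) hAm
    (fun x hx => by simp [hx])).1
  rw [← integral_sub hint1 hint2]
  refine (enorm_integral_le_lintegral_enorm _).trans ?_
  calc _ ≤ ∫⁻ X, c * ∫⁻ x in (A m)ᶜ, f x ∂X.counting ∂(P : Measure (Conf E)) := by
        refine lintegral_mono_ae ?_
        filter_upwards [hP.ae_mem_confF hA hf hK hKloc hT hTtr] with X hX
        rw [X.mulFunctional_exp hAm (hA.isBounded m) hfφ]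
        refine (norm_exp_I_mul_sub_le _ _).trans ?_
        rw [hLφ X hX]
        exact enorm_integral_sub_setIntegral_le hf hφ hc hAm hX
    _ = c * ∫⁻ X, ∫⁻ x in (A m)ᶜ, f x ∂X.counting ∂(P : Measure (Conf E)) :=
        lintegral_const_mul _
          (Conf.measurable_setLIntegral_counting hA hf.coe_nnreal_ennreal hAm.compl)
    _ ≤ _ := by
        gcongr
        exact hP.lintegral_le hA hf hK hKloc hT hTpos hAm.compl

/-- Convergence of the characteristic functionals of linear statistics. -/
theorem IsDeterminantal.tendsto_integral_exp {A : ℕ → Set E} (hA : IsExhaustion f A)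
    (hf : Measurable f) {Kn : ℕ → L2 μ →L[ℂ] L2 μ} {K : L2 μ →L[ℂ] L2 μ}
    (hKn : ∀ n, (Kn n).IsPositive) (hKnloc : ∀ n, IsLocTraceClass (Kn n)) (hK : K.IsPositive)
    (hKloc : IsLocTraceClass K) (hlim : TendstoLocTraceClass Kn K)
    {Pn : ℕ → ProbabilityMeasure (Conf E)} {P : ProbabilityMeasure (Conf E)}
    (hPn : ∀ n, IsDeterminantal (Kn n) (Pn n)) (hP : IsDeterminantal K P)
    {Tn : ℕ → L2 μ →L[ℂ] L2 μ} {T : L2 μ →L[ℂ] L2 μ}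
    (hTn : ∀ n, IsWeighted (fun x => NNReal.sqrt (f x)) (Kn n) (Tn n))
    (hT : IsWeighted (fun x => NNReal.sqrt (f x)) K T)
    (hTntr : ∀ n, IsTraceClass (Tn n)) (hTtr : IsTraceClass T)
    (hTlim : Tendsto (fun n => traceNorm (Tn n - T)) atTop (𝓝 0))
    {φ : E → ℝ} (hφ : Measurable φ) {c : ℝ≥0} (hc : ∀ x, ‖φ x‖₊ ≤ c)
    {L : Conf E → ℝ} (hL : Measurable L)
    (hLφ : ∀ X ∈ confF f, L X = ∫ x, (f x : ℝ) * φ x ∂X.counting) :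
    Tendsto (fun n => ∫ X, Complex.exp (Complex.I * L X) ∂(Pn n : Measure (Conf E))) atTop
      (𝓝 (∫ X, Complex.exp (Complex.I * L X) ∂(P : Measure (Conf E)))) := by
  have hfφ : Measurable fun x => (f x : ℝ) * φ x := hf.coe_nnreal_real.mul hφ
  let J (R : ProbabilityMeasure (Conf E)) : ℂ :=
    ∫ X, Complex.exp (Complex.I * L X) ∂(R : Measure (Conf E))
  let I (m : ℕ) (R : ProbabilityMeasure (Conf E)) : ℂ :=
    ∫ X, Conf.mulFunctional (fun x => Complex.exp (Complex.I *
        ((A m).indicator (fun x => (f x : ℝ) * φ x) x : ℝ))) X ∂(R : Measure (Conf E))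
  let d (m : ℕ) : ℝ≥0∞ := c * hsSq (sqrtAbs T ∘L chiOp μ (A m)ᶜ)
  have hd : Tendsto (fun m => d m + d m) atTop (𝓝 0) := by
    have h1 := tendsto_hsSq_chiOp_compl hTtr hA.measurableSet hA.monotone hA.iUnion_eq
    have h2 := ENNReal.Tendsto.const_mul (a := (c : ℝ≥0∞)) h1 (Or.inr (by simp))
    rw [mul_zero] at h2
    simpa using h2.add h2
  have hTpos := hT.isPositive_of_isExhaustion hA hf hK
  have hTnpos (n) := (hTn n).isPositive_of_isExhaustion hA hf (hKn n)
  have hI (m) : Tendsto (fun n => I m (Pn n)) atTop (𝓝 (I m P)) := by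
    refine tendsto_integral_mulFunctional hKn hK hKloc hlim hPn hP (C := 1) ?_ (fun x => ?_)
      (hA.measurableSet m) (hA.isBounded m) (fun x hx => by simp [hx])
    · have := hfφ.indicator (hA.measurableSet m)
      fun_prop
    · rw [mul_comm, Complex.norm_exp_ofReal_mul_I]
  -- One `d m` is the truncation error under `P`, the other the part of the error under `Pn n` that
  -- comes from the tail of `T`. The trace norm term pays for replacing the tail of `Tn n` by it.
  have hbound (m n) : edist (J (Pn n)) (J P) ≤
      (d m + d m) + (c * traceNorm (Tn n - T) + edist (I m (Pn n)) (I m P)) := by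
    have h1 : edist (J (Pn n)) (I m (Pn n)) ≤ d m + c * traceNorm (Tn n - T) := by
      rw [edist_eq_enorm_sub, ← mul_add]
      refine ((hPn n).enorm_integral_exp_sub_le hA hf (hKn n) (hKnloc n) (hTn n) (hTntr n) hφ hc
        hL hLφ m).trans ?_
      gcongr
      exact hsSq_sqrtAbs_comp_le_add hTpos (hTnpos n) (norm_chiOp_le (hA.measurableSet m).compl)
    have h2 : edist (J P) (I m P) ≤ d m := by
      rw [edist_eq_enorm_sub]
      exact hP.enorm_integral_exp_sub_le hA hf hK hKloc hT hTtr hφ hc hL hLφ m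
    calc _ ≤ edist (J (Pn n)) (I m (Pn n)) + edist (I m (Pn n)) (I m P) + edist (I m P) (J P) :=
          edist_triangle4 _ _ _ _
      _ ≤ (d m + c * traceNorm (Tn n - T)) + edist (I m (Pn n)) (I m P) + d m := by
          rw [edist_comm (I m P)]
          gcongr
      _ = _ := by ring
  rw [tendsto_iff_edist_tendsto_0, ENNReal.tendsto_nhds_zero]
  intro ε hε
  -- The truncation level is fixed before `n`, which is possible because `d m` does not depend on
  -- `n`.
  obtain ⟨m, hm⟩ := ((ENNReal.tendsto_nhds_zero.1 hd) (ε / 2) (ENNReal.half_pos hε.ne')).exists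
  have h3 : Tendsto (fun n => c * traceNorm (Tn n - T) + edist (I m (Pn n)) (I m P)) atTop
      (𝓝 0) := by
    have h4 := ENNReal.Tendsto.const_mul (a := (c : ℝ≥0∞)) hTlim (Or.inr (by simp))
    simpa using h4.add (tendsto_iff_edist_tendsto_0.1 (hI m))
  filter_upwards [(ENNReal.tendsto_nhds_zero.1 h3) (ε / 2) (ENNReal.half_pos hε.ne')] with n hn
  exact (hbound m n).trans ((add_le_add hm hn).trans_eq (ENNReal.add_halves ε))

end CharacteristicFunctional

/-! ### Measurability and coordinates of `sigmaMap`. -/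

section SigmaMap

variable {E : Type*} [MetricSpace E] [SecondCountableTopology E] [MeasurableSpace E]
  [OpensMeasurableSpace E] {f : E → ℝ≥0}

theorem testCoord_sigmaMap_of_mem (hf : Measurable f) {X : Conf E} (hX : X ∈ confF f)
    (i : TestIndex E) :
    testCoord (sigmaMap f X) i = (∫⁻ x, f x * testFn i x ∂X.counting).toReal := by
  have h1 : sigmaMap f X =
      (⟨sigmaMeasure f X, isFiniteMeasure_sigmaMeasure hX⟩ : FiniteMeasure E) := dif_pos hX
  rw [testCoord, h1]
  change (∫⁻ x, testFn i x ∂(sigmaMeasure f X)).toReal = _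
  rw [sigmaMeasure_eq_withDensity hf,
    lintegral_withDensity_eq_lintegral_mul _ hf.coe_nnreal_ennreal
      (testFn i).continuous.measurable.coe_nnreal_ennreal]
  rfl

theorem testCoord_sigmaMap_of_notMem {f : E → ℝ≥0} {X : Conf E} (hX : X ∉ confF f) (i : TestIndex E) :
    testCoord (sigmaMap f X) i = 0 := by
  have h1 : sigmaMap f X = (0 : FiniteMeasure E) := dif_neg hX
  rw [testCoord, h1, FiniteMeasure.zero_testAgainstNN_apply]
  rfl

theorem measurable_testCoord_sigmaMap {A : ℕ → Set E} (hA : IsExhaustion f A) (hf : Measurable f)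
    (i : TestIndex E) : Measurable fun X : Conf E => testCoord (sigmaMap f X) i := by
  classical
  have h1 : (fun X : Conf E => testCoord (sigmaMap f X) i) = fun X =>
      if X ∈ confF f then (∫⁻ x, f x * testFn i x ∂X.counting).toReal else 0 := by
    ext X
    split_ifs with hX
    · exact testCoord_sigmaMap_of_mem hf hX i
    · exact testCoord_sigmaMap_of_notMem hX i
  rw [h1]
  refine Measurable.ite (measurableSet_confF hA hf) ?_ measurable_const
  refine (Conf.measurable_lintegral_counting hA ?_).ennreal_toReal
  exact hf.coe_nnreal_ennreal.mul (testFn i).continuous.measurable.coe_nnreal_ennreal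

theorem measurable_sigmaMap {A : ℕ → Set E} (hA : IsExhaustion f A) (hf : Measurable f) :
    Measurable (sigmaMap f : Conf E → MFin E) :=
  measurable_of_measurable_testCoord (measurable_testCoord_sigmaMap hA hf)

theorem testCoord_sigmaMap_eq_integral (hf : Measurable f) {X : Conf E} (hX : X ∈ confF f)
    (i : TestIndex E) :
    testCoord (sigmaMap f X) i = ∫ x, (f x : ℝ) * testFn i x ∂X.counting := by
  have hm := (testFn i).continuous.measurable
  have hfm : Measurable fun x => (f x : ℝ) * testFn i x :=
    hf.coe_nnreal_real.mul hm.coe_nnreal_real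
  rw [testCoord_sigmaMap_of_mem hf hX, integral_eq_lintegral_of_nonneg_ae
    (Eventually.of_forall fun x => by positivity) hfm.aestronglyMeasurable]
  congr 1
  refine lintegral_congr fun x => ?_
  rw [ENNReal.ofReal_mul (by positivity), ENNReal.ofReal_coe_nnreal, ENNReal.ofReal_coe_nnreal]

/-- A linear combination of coordinates of `sigmaMap f X` is again a linear statistic, so the
one-dimensional result `IsDeterminantal.tendsto_integral_exp` covers all finite-dimensional
distributions. -/
theorem sum_testCoord_sigmaMap_eq_integral (hf : Measurable f) {X : Conf E} (hX : X ∈ confF f)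
    (J : Finset (TestIndex E)) (t : J → ℝ) :
    ∑ j, t j * testCoord (sigmaMap f X) j =
      ∫ x, (f x : ℝ) * ∑ j, t j * testFn j.1 x ∂X.counting := by
  have hint (j : J) : Integrable (fun x => (f x : ℝ) * testFn j.1 x) X.counting :=
    integrable_mul_counting hf (testFn j.1).continuous.measurable.coe_nnreal_real (c := 1)
      (fun x => by simpa using testFn_le_one j.1 x) hX
  simp only [testCoord_sigmaMap_eq_integral hf hX, ← integral_const_mul]
  rw [← integral_finsetSum _ fun j _ => (hint j).const_mul (t j)]
  congr 1
  ext x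
  rw [Finset.mul_sum]
  exact Finset.sum_congr rfl fun j _ => by ring

end SigmaMap

end

/-! ### The proposition. -/

theorem proposition3p11 {E : Type*} [MetricSpace E] [LocallyCompactSpace E]
    [SecondCountableTopology E] [MeasurableSpace E] [BorelSpace E]
    (μ : Measure E) [SigmaFinite μ]
    (f : E → ℝ≥0) (hf : Continuous f)
    -- self-adjoint positive contractions in `ℐ_{1,loc}(E, μ)` and their determinantal measures
    (Kn : ℕ → L2 μ →L[ℂ] L2 μ) (K : L2 μ →L[ℂ] L2 μ)
    (hKn_pos : ∀ n, (Kn n).IsPositive) (hKn_norm : ∀ n, ‖Kn n‖ ≤ 1)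
    (hKn_loc : ∀ n, IsLocTraceClass (Kn n))
    (hK_pos : K.IsPositive) (hK_norm : ‖K‖ ≤ 1) (hK_loc : IsLocTraceClass K)
    (Pn : ℕ → ProbabilityMeasure (Conf E)) (P : ProbabilityMeasure (Conf E))
    (hPn : ∀ n, IsDeterminantal (Kn n) (Pn n)) (hP : IsDeterminantal K P)
    -- `K_n → K` in `ℐ_{1,loc}(E, μ)`
    (hlim : TendstoLocTraceClass Kn K)
    -- `√f K_n √f → √f K √f` in `ℐ_1(E, μ)`
    (Tn : ℕ → L2 μ →L[ℂ] L2 μ) (T : L2 μ →L[ℂ] L2 μ)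
    (hTn : ∀ n, IsWeighted (fun x => NNReal.sqrt (f x)) (Kn n) (Tn n))
    (hT : IsWeighted (fun x => NNReal.sqrt (f x)) K T)
    (hTn_tr : ∀ n, IsTraceClass (Tn n)) (hT_tr : IsTraceClass T)
    (hTlim : Tendsto (fun n => traceNorm (Tn n - T)) atTop (𝓝 0)) :
    -- the push-forwards under `σ_f` are well defined
    Measurable (sigmaMap f : Conf E → MFin E) ∧
    (∀ n, ∀ᵐ X ∂(Pn n : Measure (Conf E)), X ∈ confF f) ∧
    (∀ᵐ X ∂(P : Measure (Conf E)), X ∈ confF f) ∧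
    -- and converge weakly in `M_fin(M_fin(E))`
    Tendsto (fun n => (pushMFin (sigmaMap f) (Pn n) : MFin (MFin E))) atTop
      (𝓝 (pushMFin (sigmaMap f) P)) := by
  obtain ⟨A, hA⟩ := exists_isExhaustion hf.measurable
  have hfm := hf.measurable
  have hσ := measurable_sigmaMap hA hfm
  refine ⟨hσ, fun n => (hPn n).ae_mem_confF hA hfm (hKn_pos n) (hKn_loc n) (hTn n) (hTn_tr n),
    hP.ae_mem_confF hA hfm hK_pos hK_loc hT hT_tr, ?_⟩
  -- Convergence is proved among probability measures, where characteristic functions determine it,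
  -- and then read in the space of finite measures.
  have key : Tendsto (fun n => (Pn n).map hσ.aemeasurable) atTop (𝓝 (P.map hσ.aemeasurable)) := by
    refine ProbabilityMeasure.tendsto_of_isInducing isInducing_testCoord fun J t => ?_
    have hexp : Continuous fun m : MFin E => Complex.exp (Complex.I *
        (∑ j, t j * testCoord m j : ℝ)) := by
      have := isInducing_testCoord (E := E).continuous
      fun_prop
    have hmap (R : ProbabilityMeasure (Conf E)) :
        ∫ m, Complex.exp (Complex.I * (∑ j, t j * testCoord m j : ℝ))
          ∂(R.map hσ.aemeasurable : Measure (MFin E)) =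
        ∫ X, Complex.exp (Complex.I * (∑ j, t j * testCoord (sigmaMap f X) j : ℝ))
          ∂(R : Measure (Conf E)) := by
      rw [ProbabilityMeasure.toMeasure_map]
      exact integral_map hσ.aemeasurable hexp.measurable.aestronglyMeasurable
    simp only [hmap]
    refine IsDeterminantal.tendsto_integral_exp hA hfm hKn_pos hKn_loc hK_pos hK_loc hlim hPn hP
      hTn hT hTn_tr hT_tr hTlim ?_ (nnnorm_sum_testFn_le J t) ?_
      fun X hX => sum_testCoord_sigmaMap_eq_integral hfm hX J t
    · have (i : TestIndex E) := (testFn i).continuous.measurable.coe_nnreal_real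
      fun_prop
    · have := measurable_testCoord_sigmaMap hA hfm
      fun_prop
  exact (ProbabilityMeasure.tendsto_nhds_iff_toFiniteMeasure_tendsto_nhds atTop).1 key
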